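/- **Setting.** $\mathbb{N}=\{1,2,\dots\}$ and $\mathcal{U}$ is the set of finite subsets of $\mathbb{N}$. Let $D\subseteq\mathbb{R}$ be a Borel set, $k:D\times D\to\mathbb{R}$ a measurable reproducing kernel, $k\neq 0$, with $k(a,a)=0$ for a point $a\in D$, and $\rho$ a probability measure on $D$ with $M:=\int_D k(x,x)\,\rho(dx)<\infty$ and $C_0:=\int_D\int_D k(x,y)\,\rho(dx)\rho(dy)>0$. Let $\gamma=(\gamma_u)_{u\in\mathcal{U}}$ be non-negative weights with $\sum_{u}\gamma_u M^{|u|}<\infty$ and $\gamma_{\{1\}}>0$. Put $k_u(\mathbf{x},\mathbf{y})=\prod_{j\in u}k(x_j,y_j)$ for $\mathbf{x},\mathbf{y}\in D^{\mathbb{N}}$, $\mathcal{X}=\{\mathbf{x}\in D^{\mathbb{N}}:\sum_u\gamma_u k_u(\mathbf{x},\mathbf{x})<\infty\}$ and $K_\gamma=\sum_u\gamma_u k_u$ on $\mathcal{X}\times\mathcal{X}$. Let $\mathcal{H}_\gamma$ be the reproducing kernel Hilbert space of $K_\gamma$, $B_\gamma$ its unit ball, and $I(f)=\int_{\mathcal{X}}f\,d\mu$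 with $\mu=\rho^{\otimes\mathbb{N}}$. Functions $f\in\mathcal{H}_\gamma$ are extended by $0$ to $D^{\mathbb{N}}\setminus\mathcal{X}$. **Algorithms, cost, error.** A randomized algorithm $Q$ is, for each outcome $\omega$ of a probability space, a deterministic adaptive algorithm: it evaluates $f$ at points chosen one after another in dependence on $\omega$ and the function values seen so far, decides from the same information when to stop, and then outputs a number depending on this information (the output is set to $0$ if it never stops). Given a cost function $c$ with values in $[0,\infty]$, ${\rm cost}_c(Q,f)$ is the sum of $c(\mathbf{x})$ over all evaluation points $\mathbf{x}$ used. Let $\$:\mathbb{N}_0\to[1,\infty]$ be non-decreasing. The set $C_{\rm nest}$ consists of the cost functions $$c_{{\rm v},a}(\mathbf{x})=\inf\{\$(|v_i|) : x_j=a \text{ for all } j\notin v_i\},\qquad \inf\emptyset=\infty,$$ for all strictly increasing sequences ${\rm v}=(v_i)_{i\in\mathbb{N}}$ of non-empty sets in $\mathcal{U}$. The class $\mathcal{A}^{\rm ran}$ consists of all randomized algorithms $Q$ such that, for every $f\in\mathcal{H}_\gamma$, $Q(f)$ is a square-integrable random variable and ${\rm cost}_c(Q,f)$ is a random variable for every $c\in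 C_{\rm nest}$. Put $${\rm cost}_{\rm nest}(Q)=\inf_{c\in C_{\rm nest}}\sup_{f\in B_\gamma}\mathbb{E}\,{\rm cost}_c(Q,f),\qquad e(Q)=\Big(\sup_{f\in B_\gamma}\mathbb{E}(I(f)-Q(f))^2\Big)^{1/2},$$ $${\rm comp}(\varepsilon)=\inf\{{\rm cost}_{\rm nest}(Q): Q\in\mathcal{A}^{\rm ran},\ e(Q)\le\varepsilon\}.$$ The problem is strongly polynomially tractable if there are $C,p\ge 0$ with ${\rm comp}(\varepsilon)\le C\varepsilon^{-p}$ for all $\varepsilon>0$; the exponent $p^{\rm ran}_{\rm nest}\in[0,\infty]$ is the infimum of all $p\ge0$ for which this holds with some $C>0$ ($\infty$ if there are none). **Weights.** For $\sigma\in\mathbb{N}$ let $u_1(\sigma),u_2(\sigma),\dots$ be the distinct non-empty $u\in\mathcal{U}$ with $|u|\le\sigma$ and $\gamma_u>0$, ordered so that $\widehat\gamma_u:=\gamma_uC_0^{|u|}$ is non-increasing, and put $${\rm decay}_{\gamma,\sigma}=\sup\{p\in\mathbb{R}:\lim_{j\to\infty}\widehat\gamma_{u_j(\sigma)}\,j^p=0\},$$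 $$t^*_\sigma=\inf\{t\ge0:\exists C_t>0\ \forall v\in\mathcal{U}:\ |\{i:u_i(\sigma)\subseteq v\}|\le C_t|v|^t\}.$$ If there are only finitely many $u_j(\sigma)$, then ${\rm decay}_{\gamma,\sigma}=\infty$. **Theorem.** Assume in addition that $\$(\nu)=\Omega(\nu^s)$ for some $s\in(0,\infty)$, and that for some $\alpha>0$ the minimal errors of univariate integration $g\mapsto\int_D g\,d\rho$ over the unit ball $B(\gamma_{\{1\}}k)$ of the reproducing kernel Hilbert space on $D$ with kernel $\gamma_{\{1\}}k$ satisfy $$e^{\rm ran}(N,B(\gamma_{\{1\}}k))=\Omega(N^{-\alpha/2})\qquad(N\to\infty),$$ where $e^{\rm ran}(N,\cdot)$ is the infimum of the worst case errors of the randomized algorithms of the above kind (now with evaluation points in $D$) whose expected cost is at most $N$ for every function in the ball, each evaluation costing $\$(1)$. Consider the nested subspace sampling model. 1. If the integration problem on $\mathcal{H}_\gamma$ is strongly polynomially tractable for the class $\mathcal{A}^{\rm ran}$, then ${\rm decay}_{\gamma,\sigma}>1$ for all $\sigma\in\mathbb{N}$. 2. If ${\rm decay}_{\gamma,\sigma}>1$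 for all $\sigma\in\mathbb{N}$, then $$p^{\rm ran}_{\rm nest}\ \ge\ \max\left\{\frac{2}{\alpha},\ \sup_{\sigma\in\mathbb{N}}\frac{2s/t^*_\sigma}{{\rm decay}_{\gamma,\sigma}-1}\right\},$$ where the term for $\sigma$ is $0$ if ${\rm decay}_{\gamma,\sigma}=\infty$. -/

import Mathlib

open MeasureTheory Filter Topology
open scoped ENNReal

noncomputable section

namespace NestedSampling

/-! ### Scalar reproducing kernels and their Hilbert spaces -/

/-- A real-valued function on `X × X` is a reproducing kernel if it is symmetric and positive
semi-definite (all finite quadratic forms `∑ cᵢ cⱼ K(xᵢ, xⱼ)` are non-negative). -/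
def IsKernel {X : Type} (K : X → X → ℝ) : Prop :=
  (Matrix.of K).PosSemidef

/-- The scalar kernel `K`, as an operator-valued kernel on the one-dimensional space `ℝ`
(multiplication by `K x y`). -/
def opKernel {X : Type} (K : X → X → ℝ) : Matrix X X (ℝ →L[ℝ] ℝ) :=
  Matrix.of fun x y => K x y • ContinuousLinearMap.id ℝ ℝ

theorem opKernel_posSemidef {X : Type} {K : X → X → ℝ} (hK : IsKernel K) :
    (opKernel K).PosSemidef := by
  have hsymm : ∀ x y, K x y = K y x := fun x y => by
    simpa using hK.1.apply y x
  have hiff := (RKHS.posSemidef_tfae (K := opKernel K)).out 0 2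
  refine hiff.mpr ⟨?_, fun vv => ?_⟩
  · have hid : star (ContinuousLinearMap.id ℝ ℝ) = ContinuousLinearMap.id ℝ ℝ :=
      star_one (ℝ →L[ℝ] ℝ)
    ext x y
    simp [opKernel, Matrix.conjTranspose_apply, hsymm y x, hid]
  · have h := hK.2 vv
    simp only [RCLike.re_to_real]
    convert! h using 1
    refine Finsupp.sum_congr fun x _ => Finsupp.sum_congr fun y _ => ?_
    simp [opKernel, hsymm y x]
    ring

/-- The reproducing kernel Hilbert space `H(K)`. -/
abbrev HilbertSpace {X : Type} (K : X → X → ℝ) (hK : IsKernel K) : Type :=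
  haveI : Fact (opKernel K).PosSemidef := ⟨opKernel_posSemidef hK⟩
  RKHS.OfKernel (opKernel K)

/-- The function `X → ℝ` that an element of `H(K)` is. -/
def toFun {X : Type} {K : X → X → ℝ} {hK : IsKernel K} (f : HilbertSpace K hK) : X → ℝ :=
  haveI : Fact (opKernel K).PosSemidef := ⟨opKernel_posSemidef hK⟩
  ⇑f

theorem IsKernel.symm {X : Type} {K : X → X → ℝ} (hK : IsKernel K) (x y : X) :
    K x y = K y x := by
  simpa using hK.1.apply y x

theorem IsKernel.diag_nonneg {X : Type} {K : X → X → ℝ} (hK : IsKernel K) (x : X) :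
    0 ≤ K x x := by
  simpa using Matrix.PosSemidef.diag_nonneg hK (i := x)

theorem IsKernel.abs_le {X : Type} {K : X → X → ℝ} (hK : IsKernel K) (x y : X) :
    |K x y| ≤ K x x + K y y := by
  have hs := hK.symm x y
  have key : ∀ c : ℝ, 0 ≤ K x x + c * K x y + c * K y x + c * c * K y y := by
    intro c
    have h := hK.2 (Finsupp.single x 1 + Finsupp.single y c)
    rw [Finsupp.sum_add_index' (by simp) (by intros; simp [← Finsupp.sum_add, add_mul])] at h
    rw [Finsupp.sum_single_index (by simp), Finsupp.sum_single_index (by simp),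
      Finsupp.sum_add_index' (by simp) (by intros; ring),
      Finsupp.sum_add_index' (by simp) (by intros; ring)] at h
    simp at h
    nlinarith [h]
  have h1 := key 1
  have h2 := key (-1)
  have := hK.diag_nonneg x
  have := hK.diag_nonneg y
  rw [_root_.abs_le]
  constructor <;> nlinarith

theorem IsKernel.smul {X : Type} {K : X → X → ℝ} (hK : IsKernel K) {c : ℝ} (hc : 0 ≤ c) :
    IsKernel fun x y => c * K x y :=
  Matrix.PosSemidef.smul (α := ℝ) hK hc

theorem IsKernel.comp {X Y : Type} {K : X → X → ℝ} (hK : IsKernel K) (e : Y → X) :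
    IsKernel fun x y => K (e x) (e y) :=
  Matrix.PosSemidef.submatrix hK e

theorem IsKernel.mul {X : Type} {K L : X → X → ℝ} (hK : IsKernel K) (hL : IsKernel L) :
    IsKernel fun x y => K x y * L x y :=
  Matrix.PosSemidef.hadamard hK hL

theorem IsKernel.one {X : Type} : IsKernel fun _ _ : X => (1 : ℝ) := by
  refine ⟨by ext; simp, fun c => ?_⟩
  have : (c.sum fun i xi => c.sum fun j xj => star xi * (Matrix.of fun _ _ : X => (1 : ℝ)) i j * xj)
      = (c.sum fun _ t => t) * (c.sum fun _ t => t) := by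
    simp [Finsupp.mul_sum, mul_comm]
  rw [this]
  exact mul_self_nonneg _

theorem IsKernel.prod {X ι : Type} {K : ι → X → X → ℝ} (hK : ∀ i, IsKernel (K i))
    (s : Finset ι) : IsKernel fun x y => ∏ i ∈ s, K i x y := by
  classical
  induction s using Finset.induction_on with
  | empty => simpa using IsKernel.one
  | insert i s hi ih =>
    simp only [Finset.prod_insert hi]
    exact (hK i).mul ih

theorem IsKernel.tsum {X ι : Type} {K : ι → X → X → ℝ} (hK : ∀ i, IsKernel (K i))
    (hs : ∀ x, Summable fun i => K i x x) : IsKernel fun x y => ∑' i, K i x y := by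
  have hsum : ∀ x y, Summable fun i => K i x y := fun x y =>
    Summable.of_norm_bounded ((hs x).add (hs y)) fun i => (hK i).abs_le x y
  refine ⟨?_, fun c => ?_⟩
  · ext x y
    simp only [Matrix.conjTranspose_apply, Matrix.of_apply, star_trivial]
    exact tsum_congr fun i => (hK i).symm y x
  · have h : HasSum
        (fun i => c.sum fun x cx => c.sum fun y cy => star cx * (Matrix.of (K i)) x y * cy)
        (c.sum fun x cx => c.sum fun y cy =>
          star cx * (Matrix.of fun x y => ∑' i, K i x y) x y * cy) := by
      refine hasSum_sum fun x _ => hasSum_sum fun y _ => ?_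
      exact ((hsum x y).hasSum.mul_left _).mul_right _
    exact h.nonneg fun i => (hK i).2 c

/-! ### Randomized algorithms -/

/-- A randomized algorithm with access to functions `f : X → ℝ` through function values.
For each random outcome `ω`, it is a deterministic adaptive algorithm: given the list of function
values seen so far, `query` is the next sample point, or `none` if the algorithm stops;
`output` is the number returned after stopping. -/
structure RandAlg (X : Type) where
  Ω : Type
  [mΩ : MeasurableSpace Ω]
  P : Measure Ω
  [isProb : IsProbabilityMeasure P]
  query : Ω → List ℝ → Option X
  output : Ω → List ℝ → ℝ

attribute [instance] RandAlg.mΩ RandAlg.isProb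

namespace RandAlg

variable {X : Type} (A : RandAlg X)

/-- The function values seen after `n` steps, in order (constant once the algorithm stopped). -/
def transcript (f : X → ℝ) (ω : A.Ω) : ℕ → List ℝ
  | 0 => []
  | n + 1 =>
    match A.query ω (transcript f ω n) with
    | none => transcript f ω n
    | some x => transcript f ω n ++ [f x]

/-- The `n`-th sample point (`none` if the algorithm has stopped before). -/
def point (f : X → ℝ) (ω : A.Ω) (n : ℕ) : Option X :=
  A.query ω (A.transcript f ω n)

open Classical in
/-- The result `Q(ω, f)`; it is `0` if the algorithm never stops (then its cost is infinite). -/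
def result (f : X → ℝ) (ω : A.Ω) : ℝ :=
  if h : ∃ n, A.point f ω n = none then A.output ω (A.transcript f ω (Nat.find h)) else 0

/-- The sum of the costs of all function evaluations, `c x` being the cost of one at `x`. -/
def cost (c : X → ℝ≥0∞) (f : X → ℝ) (ω : A.Ω) : ℝ≥0∞ :=
  ∑' n, (A.point f ω n).elim 0 c

end RandAlg

/-- The data of an integration problem: the function space, its unit ball, the functional
to be approximated, and the cost functions among which one may choose for an algorithm. -/
structure Problem (X : Type) where
  space : Set (X → ℝ)
  ball : Set (X → ℝ)
  functional : (X → ℝ) → ℝ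
  costs : Set (X → ℝ≥0∞)

namespace Problem

variable {X : Type} (T : Problem X)

/-- The class of all randomized algorithms: for all `f` in the space the result is a
square-integrable random variable and the cost is a random variable. -/
def IsAdmissible (A : RandAlg X) : Prop :=
  ∀ f ∈ T.space, (Measurable (A.result f) ∧ MemLp (A.result f) 2 A.P) ∧
    ∀ c ∈ T.costs, Measurable (A.cost c f)

/-- The worst case cost `inf_c sup_f E(cost_c(Q, f))` over the unit ball. -/
def worstCost (A : RandAlg X) : ℝ≥0∞ :=
  ⨅ c ∈ T.costs, ⨆ f ∈ T.ball, ∫⁻ ω, A.cost c f ω ∂A.P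

/-- The randomized worst case error `(sup_f E((I(f) - Q(f))²))^(1/2)` over the unit ball. -/
def error (A : RandAlg X) : ℝ≥0∞ :=
  (⨆ f ∈ T.ball,
    ∫⁻ ω, ENNReal.ofReal ((T.functional f - A.result f ω) ^ 2) ∂A.P) ^ (1 / 2 : ℝ)

/-- The `N`-th minimal error. -/
def minError (N : ℝ) : ℝ≥0∞ :=
  ⨅ (A : RandAlg X) (_ : T.IsAdmissible A) (_ : T.worstCost A ≤ ENNReal.ofReal N), T.error A

/-- The `ε`-complexity. -/
def comp (ε : ℝ) : ℝ≥0∞ :=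
  ⨅ (A : RandAlg X) (_ : T.IsAdmissible A) (_ : T.error A ≤ ENNReal.ofReal ε), T.worstCost A

/-- `comp(ε) ≤ C ε^(-p)` for all `ε > 0`. -/
def CompBound (C p : ℝ) : Prop :=
  ∀ ε : ℝ, 0 < ε → T.comp ε ≤ ENNReal.ofReal (C * ε ^ (-p))

def StronglyPolynomiallyTractable : Prop :=
  ∃ C p : ℝ, 0 ≤ C ∧ 0 ≤ p ∧ T.CompBound C p

/-- The exponent of strong polynomial tractability (`⊤` if the problem is not strongly
polynomially tractable). -/
def exponent : EReal :=
  sInf ((fun p : ℝ => (p : EReal)) '' {p : ℝ | 0 ≤ p ∧ ∃ C : ℝ, 0 < C ∧ T.CompBound C p})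

end Problem

/-! ### The weighted space of functions of infinitely many variables -/

/-- The data of the integration problem and the standing assumptions on them. The coordinates are
indexed by the positive integers `ℕ+`; `price ν` is the cost `$(ν)` of a function evaluation
with `ν` active variables. -/
structure Setting where
  /-- the univariate domain -/
  D : Set ℝ
  measurableSet_D : MeasurableSet D
  /-- the univariate kernel, anchored at `a` -/
  k : D → D → ℝ
  measurable_k : Measurable (Function.uncurry k)
  isKernel_k : IsKernel k
  a : D
  anchored : k a a = 0
  nontrivial_k : k ≠ 0
  /-- the probability measure on `D` -/
  ρ : Measure D
  isProb : IsProbabilityMeasure ρ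
  integrable_diag : Integrable (fun x => k x x) ρ
  /-- the weights -/
  γ : Finset ℕ+ → ℝ
  γ_nonneg : ∀ u, 0 ≤ γ u
  summable_γ : Summable fun u : Finset ℕ+ => γ u * (∫ x, k x x ∂ρ) ^ u.card
  /-- the integration functional is non-trivial -/
  C₀_pos : 0 < ∫ x, ∫ y, k x y ∂ρ ∂ρ
  exists_γ_pos : ∃ u, 0 < γ u
  price : ℕ → ℝ≥0∞
  price_mono : Monotone price
  one_le_price : ∀ ν, 1 ≤ price ν

attribute [instance] Setting.isProb

namespace Setting

variable (S : Setting)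

/-- Sequences of points of the univariate domain. -/
abbrev Pt : Type := ℕ+ → S.D

/-- `k_u(x, y) = ∏_{j ∈ u} k(x_j, y_j)`. -/
def kProd (u : Finset ℕ+) (x y : S.Pt) : ℝ :=
  ∏ j ∈ u, S.k (x j) (y j)

/-- The domain `𝒳` of the functions of infinitely many variables. -/
def domain : Set S.Pt :=
  {x | Summable fun u : Finset ℕ+ => S.γ u * S.kProd u x x}

/-- The kernel `K_γ = ∑_u γ_u k_u` on `𝒳`. -/
def Kγ (x y : S.domain) : ℝ :=
  ∑' u : Finset ℕ+, S.γ u * S.kProd u x y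

theorem isKernel_Kγ : IsKernel S.Kγ :=
  IsKernel.tsum (K := fun u (x y : S.domain) => S.γ u * S.kProd u x y)
    (fun u => ((IsKernel.prod (fun j => S.isKernel_k.comp (fun x : S.Pt => x j)) u).smul
      (S.γ_nonneg u)).comp (fun x : S.domain => (x : S.Pt)))
    (fun x => x.2)

/-- The space `ℋ_γ = H(K_γ)`. -/
abbrev Hγ : Type := HilbertSpace S.Kγ S.isKernel_Kγ

open Classical in
/-- An element of `ℋ_γ` as a function on all of `D^ℕ`, with the convention `f = 0` outside `𝒳`. -/
def extend (f : S.Hγ) (x : S.Pt) : ℝ :=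
  if h : x ∈ S.domain then toFun f ⟨x, h⟩ else 0

/-- The infinite product measure of `ρ`. -/
def μ : Measure S.Pt := Measure.infinitePi fun _ => S.ρ

/-- The affine subspace `𝒳_{v,a}`. -/
def subspace (v : Finset ℕ+) : Set S.Pt :=
  {x | ∀ j, j ∉ v → x j = S.a}

/-- The cost function `c_{v,a}` of a sequence `v` of sets of coordinates. -/
def nestedCost (v : ℕ → Finset ℕ+) (x : S.Pt) : ℝ≥0∞ :=
  ⨅ (i : ℕ) (_ : x ∈ S.subspace (v i)), S.price (v i).card

/-- Integration on `ℋ_γ` in the nested subspace sampling model. -/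
def nested : Problem S.Pt where
  space := {g | ∃ f : S.Hγ, S.extend f = g}
  ball := {g | ∃ f : S.Hγ, ‖f‖ ≤ 1 ∧ S.extend f = g}
  functional g := ∫ x in S.domain, g x ∂S.μ
  costs := {c | ∃ v : ℕ → Finset ℕ+, StrictMono v ∧ (∀ i, (v i).Nonempty) ∧ c = S.nestedCost v}

/-- Univariate integration on `H(γ_{1} k)`; every evaluation has one active variable. -/
def univariate : Problem S.D where
  space := {g | ∃ f : HilbertSpace (fun x y => S.γ {1} * S.k x y)
    (S.isKernel_k.smul (S.γ_nonneg {1})), toFun f = g}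
  ball := {g | ∃ f : HilbertSpace (fun x y => S.γ {1} * S.k x y)
    (S.isKernel_k.smul (S.γ_nonneg {1})), ‖f‖ ≤ 1 ∧ toFun f = g}
  functional g := ∫ x, g x ∂S.ρ
  costs := {fun _ => S.price 1}

/-! ### Cut-off weights, decay and `t*` -/

/-- The cut-off weights `γ^(σ)`. -/
def cutoff (σ : ℕ) (u : Finset ℕ+) : ℝ :=
  if u.card ≤ σ then S.γ u else 0

def C₀ : ℝ := ∫ x, ∫ y, S.k x y ∂S.ρ ∂S.ρ

/-- The weights `γ̂_u^(σ) = γ_u^(σ) C₀^|u|`. -/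
def cutoffHat (σ : ℕ) (u : Finset ℕ+) : ℝ :=
  S.cutoff σ u * S.C₀ ^ u.card

/-- The non-empty sets with positive cut-off weight. -/
def support (σ : ℕ) : Set (Finset ℕ+) :=
  {u | u.Nonempty ∧ 0 < S.cutoff σ u}

/-- The positions (from `0`) of an enumeration of `support σ`: all of `ℕ` if it is infinite,
an initial segment otherwise. -/
def positions (σ : ℕ) : Set ℕ :=
  {j | (j : ℕ∞) < (S.support σ).encard}

/-- `e 0, e 1, …` enumerates `u₁(σ), u₂(σ), …`, i.e. the distinct elements of `support σ` in the
order of decreasing weights `γ̂^(σ)`; values of `e` outside `positions σ` are irrelevant. -/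
def IsOrderedEnum (σ : ℕ) (e : ℕ → Finset ℕ+) : Prop :=
  Set.BijOn e (S.positions σ) (S.support σ) ∧
    AntitoneOn (fun j => S.cutoffHat σ (e j)) (S.positions σ)

open Classical in
/-- `decay_{γ,σ}`. The set `u_j(σ)` is `e (j - 1)`, which gives the factor `(j + 1)^p`. If there are
only finitely many sets `u_j(σ)`, the limit is `0` for all `p` and the value is `⊤`. -/
def decay (σ : ℕ) : EReal :=
  sSup ((fun p : ℝ => (p : EReal)) '' {p : ℝ | ∃ e, S.IsOrderedEnum σ e ∧
    Tendsto (fun j : ℕ =>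
      if j ∈ S.positions σ then S.cutoffHat σ (e j) * ((j : ℝ) + 1) ^ p else 0) atTop (𝓝 0)})

/-- `t*_σ`. The sets `u_i(σ)` are distinct, so indices `i` with `u_i(σ) ⊆ v` are counted by counting
the sets. -/
def tStar (σ : ℕ) : EReal :=
  sInf ((fun t : ℝ => (t : EReal)) '' {t : ℝ | 0 ≤ t ∧ ∃ C : ℝ, 0 < C ∧ ∀ v : Finset ℕ+,
    (({u | u ∈ S.support σ ∧ u ⊆ v} : Set (Finset ℕ+)).ncard : ℝ) ≤ C * (v.card : ℝ) ^ t})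

end Setting

end NestedSampling

end

/-! Both claims rest on fooling functions. Since `k` vanishes at the anchor, `ℋ_γ` contains pairwise
orthogonal components with kernels `γ_u k_u`, and a component with `u ⊈ V` vanishes on `𝒳_{V,a}`. On
the span of finitely many representers, integration attains the norm `(∑ γ̂_u)^(1/2)` at the
normalised sum of the representers (`exists_extremal`). For a nested cost function, all points of
cost at most `2N` lie in one `𝒳_{V,a}` with `|V| = O(N^(1/s))`, because the largest affordable `v_i`
contains the others (`exists_cover`). By Markov's inequality, an algorithm of expected cost at most
`N` fails to distinguish `f` from `-f` with probability at least `1/2`, so `∑_{u ∈ F} γ̂_u ≤ 2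
e(Q)²` for every finite family `F` of unseen sets (`exists_unseen`).

Suppose `comp(ε) ≤ C ε^(-p)`. Then only `O(ε^(-pt/s))` of the sets `u_i` are subsets of `V`. Choose
`ε` so that this is at most half of the first `m` sets. The unseen half gives `(m/2) γ̂_{u_m} ≤ 2ε²`
with `ε` of order `m^(-s/(pt))`, hence a decay of at least `1 + 2s/(pt)` (`le_decay`). The exponent
`t = σ` is always admissible, which yields claim 1; letting `t` decrease to `t*_σ` yields the second
term of the maximum.

The bound `2/α` holds because `H(γ_{1} k)` sits isometrically in `ℋ_γ` as functions of `x₁`, so an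
algorithm on `ℋ_γ` gives a univariate one with no larger cost or error (`minError_univariate_le`).
The delicate point is measurability: the cost of the given algorithm is a random variable, but its
number of evaluations need not be. The univariate algorithm is therefore padded with dummy
evaluations until their number is a function of that cost (`simulate`). -/

namespace NestedSampling

/-! ### Reproducing kernel Hilbert spaces -/

section RKHS

variable {X : Type} {K : X → X → ℝ} {hK : IsKernel K}

/-- The function `K(·, x)` as an element of `H(K)`. -/
noncomputable def kfun (hK : IsKernel K) (x : X) : HilbertSpace K hK :=
  haveI : Fact (opKernel K).PosSemidef := ⟨opKernel_posSemidef hK⟩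
  RKHS.kerFun (RKHS.OfKernel (opKernel K)) x 1

theorem inner_kfun (x : X) (f : HilbertSpace K hK) : inner ℝ (kfun hK x) f = toFun f x := by
  have : Fact (opKernel K).PosSemidef := ⟨opKernel_posSemidef hK⟩
  have := RKHS.kerFun_inner (H := RKHS.OfKernel (opKernel K)) x (1 : ℝ) f
  rw [kfun, this]
  simp [toFun]

theorem toFun_kfun (x y : X) : toFun (kfun hK y) x = K x y := by
  have : Fact (opKernel K).PosSemidef := ⟨opKernel_posSemidef hK⟩
  have := RKHS.kerFun_apply (H := RKHS.OfKernel (opKernel K)) y (1 : ℝ) x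
  rw [toFun, kfun, this, RKHS.OfKernel.kernel_ofKernel]
  simp [opKernel]

theorem toFun_add (f g : HilbertSpace K hK) (x : X) : toFun (f + g) x = toFun f x + toFun g x := by
  simp [← inner_kfun, inner_add_right]

theorem toFun_neg (f : HilbertSpace K hK) (x : X) : toFun (-f) x = -toFun f x := by
  simp [← inner_kfun, inner_neg_right]

theorem toFun_smul (c : ℝ) (f : HilbertSpace K hK) (x : X) :
    toFun (c • f) x = c * toFun f x := by
  simp [← inner_kfun, inner_smul_right]

theorem toFun_sum {ι : Type*} (s : Finset ι) (f : ι → HilbertSpace K hK) (x : X) :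
    toFun (∑ i ∈ s, f i) x = ∑ i ∈ s, toFun (f i) x := by
  simp [← inner_kfun, inner_sum]

theorem continuous_toFun (x : X) : Continuous fun f : HilbertSpace K hK => toFun f x := by
  simp only [← inner_kfun]
  fun_prop

/-- A function orthogonal to every kernel section vanishes at every point by the reproducing
property. -/
theorem dense_span_kfun (hK : IsKernel K) :
    Dense (Submodule.span ℝ (Set.range (kfun hK)) : Set (HilbertSpace K hK)) := by
  have : Fact (opKernel K).PosSemidef := ⟨opKernel_posSemidef hK⟩
  rw [Submodule.dense_iff_topologicalClosure_eq_top, Submodule.topologicalClosure_eq_top_iff,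
    Submodule.eq_bot_iff]
  intro f hf
  refine RKHS.ext fun x => ?_
  have h := (Submodule.mem_orthogonal _ _).1 hf _ (Submodule.subset_span ⟨x, rfl⟩)
  rw [inner_kfun] at h
  simpa [toFun] using h

/-- Cauchy–Schwarz for two kernel sections in `H(K)`. -/
theorem IsKernel.sq_le (hK : IsKernel K) (x y : X) : K x y ^ 2 ≤ K x x * K y y := by
  have h := abs_real_inner_le_norm (kfun hK x) (kfun hK y)
  have hx : ∀ z, ‖kfun hK z‖ ^ 2 = K z z := fun z => by
    rw [← real_inner_self_eq_norm_sq, inner_kfun, toFun_kfun]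
  rw [inner_kfun, toFun_kfun] at h
  rw [← hx, ← hx, ← mul_pow, ← sq_abs]
  gcongr

/-- Elements of `H(K)` inherit measurability from the functions `K(·, y)`. -/
theorem measurable_toFun [MeasurableSpace X] (hm : ∀ y, Measurable fun x => K x y)
    (f : HilbertSpace K hK) : Measurable (toFun f) := by
  obtain ⟨g, hg, hgf⟩ := mem_closure_iff_seq_limit.1 ((dense_span_kfun hK) f)
  refine measurable_of_tendsto_metrizable (f := fun n => toFun (g n)) (fun n => ?_)
    (tendsto_pi_nhds.2 fun x => ((continuous_toFun x).tendsto f).comp hgf)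
  refine Submodule.span_induction (p := fun g _ => Measurable (toFun g)) ?_ ?_ ?_ ?_ (hg n)
  · rintro _ ⟨y, rfl⟩
    have : toFun (kfun hK y) = fun x => K x y := funext fun x => toFun_kfun x y
    exact this ▸ hm y
  · have : toFun (0 : HilbertSpace K hK) = fun _ => 0 := funext fun x => by simp [← inner_kfun]
    exact this ▸ measurable_const
  · intro f g _ _ hf hg
    have : toFun (f + g) = fun x => toFun f x + toFun g x := funext fun x => toFun_add f g x
    exact this ▸ hf.add hg
  · intro c f _ hf
    have : toFun (c • f) = fun x => c * toFun f x := funext fun x => toFun_smul c f x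
    exact this ▸ hf.const_mul c

/-- A map `φ` from `X` into a Hilbert space whose Gram matrix is `K` extends to `H(K)`. -/
theorem exists_norm_eq_of_gram {H : Type*} [NormedAddCommGroup H] [InnerProductSpace ℝ H]
    [CompleteSpace H] (φ : X → H) (hφ : ∀ x y, inner ℝ (φ x) (φ y) = K x y)
    (f : HilbertSpace K hK) :
    ∃ F : H, ‖F‖ = ‖f‖ ∧ ∀ (g : H) (x : X), (∀ y, inner ℝ g (φ y) = K x y) →
      inner ℝ g F = toFun f x := by
  -- Equal Gram matrices give `‖T c‖ = ‖T' c‖`. If `T (c n)` converges to `f`, then `T' (c n)` is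
  -- Cauchy, and its limit is the required `F`.
  let T : (X →₀ ℝ) →ₗ[ℝ] HilbertSpace K hK := Finsupp.linearCombination ℝ (kfun hK)
  let T' : (X →₀ ℝ) →ₗ[ℝ] H := Finsupp.linearCombination ℝ φ
  have hinner : ∀ c, inner ℝ (T c) (T c) = inner ℝ (T' c) (T' c) := fun c => by
    simp only [T, T', Finsupp.linearCombination_apply, Finsupp.sum, sum_inner, inner_sum,
      inner_smul_left, inner_smul_right, inner_kfun, toFun_kfun, hφ]
  have hnorm : ∀ c, ‖T c‖ = ‖T' c‖ := fun c => by
    rw [norm_eq_sqrt_real_inner, norm_eq_sqrt_real_inner, hinner]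
  obtain ⟨g, hg, hgf⟩ := mem_closure_iff_seq_limit.1 ((dense_span_kfun hK) f)
  have hex : ∀ n, ∃ c, T c = g n := fun n => by
    have := hg n
    rwa [SetLike.mem_coe, ← Finsupp.range_linearCombination, LinearMap.mem_range] at this
  choose c hc using hex
  have hcau : CauchySeq fun n => T' (c n) := by
    have h := hgf.cauchySeq
    rw [Metric.cauchySeq_iff] at h ⊢
    intro ε hε
    obtain ⟨N, hN⟩ := h ε hε
    refine ⟨N, fun m hm n hn => ?_⟩
    have := hN m hm n hn
    rwa [dist_eq_norm, ← hc, ← hc, ← map_sub, hnorm, map_sub, ← dist_eq_norm] at this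
  obtain ⟨F, hF⟩ := cauchySeq_tendsto_of_complete hcau
  refine ⟨F, tendsto_nhds_unique hF.norm ?_, fun w x hw => ?_⟩
  · simpa only [← hnorm, hc] using hgf.norm
  · refine tendsto_nhds_unique ((tendsto_const_nhds (x := w)).inner (𝕜 := ℝ) hF) ?_
    have h2 := ((continuous_toFun x).tendsto f).comp hgf
    refine h2.congr fun n => ?_
    simp only [Function.comp, ← hc, T, T', Finsupp.linearCombination_apply, Finsupp.sum, toFun_sum,
      toFun_smul, toFun_kfun, inner_sum, inner_smul_right, hw]

end RKHS

end NestedSampling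

namespace NestedSampling

/-! ### The anchored decomposition of `ℋ_γ` -/

/-- Möbius inversion on the Boolean lattice. For `u ⊆ w` the sum is the expansion of a product over
`w` with factor `1` at `j ∈ u` and `1 - 1` elsewhere. -/
theorem sum_powerset_neg_one_pow_ite {ι : Type*} [DecidableEq ι] (u w : Finset ι) :
    ∑ v ∈ w.powerset, (-1 : ℝ) ^ (w \ v).card * (if u ⊆ v then 1 else 0) =
      if u = w then 1 else 0 := by
  by_cases huw : u ⊆ w
  · have h := Finset.prod_add (fun _ => (1 : ℝ)) (fun j => if j ∈ u then 0 else -1) w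
    have hl : ∏ j ∈ w, ((1 : ℝ) + if j ∈ u then 0 else -1) = if u = w then 1 else 0 := by
      split_ifs with he
      · subst he
        exact Finset.prod_eq_one fun j hj => by simp [hj]
      · obtain ⟨j, hjw, hju⟩ := Finset.exists_of_ssubset (Finset.ssubset_iff_subset_ne.2 ⟨huw, he⟩)
        exact Finset.prod_eq_zero hjw (by simp [hju])
    rw [← hl, h]
    refine Finset.sum_congr rfl fun v hv => ?_
    rw [Finset.prod_const_one, one_mul]
    split_ifs with huv
    · rw [Finset.prod_congr rfl (g := fun _ => (-1 : ℝ)), Finset.prod_const, mul_one]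
      intro j hj
      rw [if_neg fun hju => (Finset.mem_sdiff.1 hj).2 (huv hju)]
    · obtain ⟨j, hju, hjv⟩ := Finset.not_subset.1 huv
      rw [mul_zero, Finset.prod_eq_zero (i := j)]
      · exact Finset.mem_sdiff.2 ⟨huw hju, hjv⟩
      · simp [hju]
  · rw [if_neg fun h => huw h.subset]
    refine Finset.sum_eq_zero fun v hv => ?_
    rw [if_neg fun h => huw (h.trans (Finset.mem_powerset.1 hv)), mul_zero]

namespace Setting

variable (S : Setting)

theorem k_anchor (x : S.D) : S.k S.a x = 0 := by
  have h := S.isKernel_k.sq_le S.a x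
  rw [S.anchored, zero_mul] at h
  exact pow_eq_zero_iff (two_ne_zero) |>.1 (le_antisymm h (sq_nonneg _))

theorem kProd_symm (u : Finset ℕ+) (x y : S.Pt) : S.kProd u x y = S.kProd u y x :=
  Finset.prod_congr rfl fun _ _ => S.isKernel_k.symm _ _

theorem kProd_diag_nonneg (u : Finset ℕ+) (x : S.Pt) : 0 ≤ S.kProd u x x :=
  Finset.prod_nonneg fun _ _ => S.isKernel_k.diag_nonneg _

theorem kProd_eq_zero_of_mem_subspace {u v : Finset ℕ+} (huv : ¬u ⊆ v) {x : S.Pt}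
    (hx : x ∈ S.subspace v) (y : S.Pt) : S.kProd u x y = 0 := by
  obtain ⟨j, hju, hjv⟩ := Finset.not_subset.1 huv
  exact Finset.prod_eq_zero hju (by rw [hx j hjv, k_anchor])

/-- The point `(x_v, a)`. -/
noncomputable def proj (v : Finset ℕ+) (x : S.Pt) : S.Pt := fun j => if j ∈ v then x j else S.a

theorem proj_mem_subspace (v : Finset ℕ+) (x : S.Pt) : S.proj v x ∈ S.subspace v :=
  fun j hj => by simp [proj, hj]

theorem kProd_proj (u v : Finset ℕ+) (x y : S.Pt) :
    S.kProd u (S.proj v x) y = S.kProd u x y * (if u ⊆ v then 1 else 0) := by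
  split_ifs with h
  · rw [mul_one]
    exact Finset.prod_congr rfl fun j hj => by simp [proj, h hj]
  · rw [mul_zero]
    exact S.kProd_eq_zero_of_mem_subspace h (S.proj_mem_subspace v x) y

theorem subspace_subset_domain (v : Finset ℕ+) : S.subspace v ⊆ S.domain := fun x hx =>
  summable_of_ne_finset_zero (s := v.powerset) fun u hu => by
    rw [S.kProd_eq_zero_of_mem_subspace (by simpa using hu) hx, mul_zero]

/-- The point `(x_v, a)` as an element of the domain `𝒳`. -/
noncomputable def projDomain (v : Finset ℕ+) (x : S.Pt) : S.domain :=
  ⟨S.proj v x, S.subspace_subset_domain v (S.proj_mem_subspace v x)⟩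

/-- Anchoring kills all terms with `u ⊈ v`, so the series becomes a finite sum to which Möbius
inversion applies. -/
theorem Kγ_proj (v : Finset ℕ+) (x : S.domain) (y : S.Pt) :
    S.Kγ x (S.projDomain v y) =
      ∑ u ∈ v.powerset, S.γ u * S.kProd u x y := by
  rw [Kγ, tsum_eq_sum (s := v.powerset)]
  · refine Finset.sum_congr rfl fun u hu => ?_
    rw [projDomain, S.kProd_symm, S.kProd_proj, if_pos (Finset.mem_powerset.1 hu), mul_one,
      S.kProd_symm]
  · intro u hu
    rw [projDomain, S.kProd_symm, S.kProd_proj, if_neg (by simpa using hu), mul_zero, mul_zero]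

/-- The function `γ_u k_u(·, y)` as an element of `ℋ_γ`. -/
noncomputable def component (u : Finset ℕ+) (y : S.Pt) : S.Hγ :=
  ∑ v ∈ u.powerset, (-1 : ℝ) ^ (u \ v).card • kfun S.isKernel_Kγ (S.projDomain v y)

theorem inner_component (w : Finset ℕ+) (y : S.Pt) (g : S.Hγ) :
    inner ℝ (S.component w y) g =
      ∑ v ∈ w.powerset, (-1 : ℝ) ^ (w \ v).card * toFun g (S.projDomain v y) := by
  simp [component, sum_inner, inner_smul_left, inner_kfun]

/-- Möbius inversion of `Kγ_proj`: the alternating sum over anchored projections isolates the term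
`u = w`. -/
theorem toFun_component (w : Finset ℕ+) (y : S.Pt) (x : S.domain) :
    toFun (S.component w y) x = S.γ w * S.kProd w x y := by
  have h : ∀ v ∈ w.powerset, S.Kγ x (S.projDomain v y) =
      ∑ u ∈ w.powerset, S.γ u * S.kProd u x y * (if u ⊆ v then 1 else 0) := fun v hv => by
    rw [Kγ_proj, ← Finset.sum_subset (Finset.powerset_mono.2 (Finset.mem_powerset.1 hv))]
    · exact Finset.sum_congr rfl fun u hu => by simp [Finset.mem_powerset.1 hu]
    · intro u _ hu
      rw [if_neg (by simpa using hu), mul_zero]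
  simp only [component, toFun_sum, toFun_smul, toFun_kfun]
  rw [Finset.sum_congr rfl fun v hv => by rw [h v hv, Finset.mul_sum], Finset.sum_comm,
    Finset.sum_congr rfl fun u _ => Finset.sum_congr rfl fun v _ => mul_left_comm _ _ _]
  simp only [← Finset.mul_sum, sum_powerset_neg_one_pow_ite]
  simp

/-- Orthogonality of distinct components: the inner product is an alternating sum of values of `γ_u
k_u(·, y)` at anchored projections of `z`, and Möbius inversion leaves only `u = w`. -/
theorem inner_component_component (u w : Finset ℕ+) (y z : S.Pt) :
    inner ℝ (S.component w z) (S.component u y) =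
      if u = w then S.γ u * S.kProd u z y else 0 := by
  simp only [inner_component, toFun_component, projDomain, kProd_proj, ← mul_assoc]
  have h := sum_powerset_neg_one_pow_ite u w
  calc _ = ∑ v ∈ w.powerset, S.γ u * S.kProd u z y *
        ((-1 : ℝ) ^ (w \ v).card * (if u ⊆ v then 1 else 0)) :=
        Finset.sum_congr rfl fun v _ => by ring
    _ = _ := by rw [← Finset.mul_sum, h, mul_ite, mul_one, mul_zero]

theorem norm_component_sq (u : Finset ℕ+) (y : S.Pt) :
    ‖S.component u y‖ ^ 2 = S.γ u * S.kProd u y y := by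
  rw [← real_inner_self_eq_norm_sq, inner_component_component, if_pos rfl]

end Setting

end NestedSampling

/-! ### Integrals of product functions over the infinite product measure -/

namespace NestedSampling

theorem integrable_prod_infinitePi {ι E : Type*} [MeasurableSpace E] {ρ : Measure E}
    [IsProbabilityMeasure ρ] {g : ι → E → ℝ} (hg : ∀ j, Integrable (g j) ρ) (u : Finset ι) :
    Integrable (fun x : ι → E => ∏ j ∈ u, g j (x j)) (Measure.infinitePi fun _ => ρ) := by
  have h : Integrable (fun x : u → E => ∏ j : u, g j (x j)) (Measure.pi fun _ => ρ) :=
    Integrable.fintype_prod fun j => hg j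
  rw [← Measure.infinitePi_map_restrict (fun _ => ρ) (I := u)] at h
  have h2 := h.comp_measurable (Finset.measurable_restrict u)
  simpa [Function.comp_def, Finset.prod_coe_sort u, Finset.restrict,
    Finset.prod_attach u (fun j => g j _)] using h2

/-- The integrand depends only on the coordinates in `u`, so the claim is Fubini for the finite
marginal. -/
theorem integral_prod_infinitePi {ι E : Type*} [MeasurableSpace E] {ρ : Measure E}
    [IsProbabilityMeasure ρ] {g : ι → E → ℝ} (hg : ∀ j, Integrable (g j) ρ) (u : Finset ι) :
    ∫ x : ι → E, ∏ j ∈ u, g j (x j) ∂(Measure.infinitePi fun _ => ρ) =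
      ∏ j ∈ u, ∫ t, g j t ∂ρ := by
  have h : Integrable (fun x : u → E => ∏ j : u, g j (x j)) (Measure.pi fun _ => ρ) :=
    Integrable.fintype_prod fun j => hg j
  have h1 := integral_restrict_infinitePi (fun _ => ρ) h.aestronglyMeasurable
  rw [integral_fintype_prod_eq_prod (f := fun (j : u) t => g j t)] at h1
  rw [← Finset.prod_coe_sort u, ← h1]
  refine integral_congr_ae (ae_of_all _ fun x => ?_)
  simp [Finset.restrict, Finset.prod_attach u (fun j => g j (x j))]

namespace Setting

variable (S : Setting)

/-! ### Integration on `ℋ_γ` -/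

instance : IsProbabilityMeasure S.μ := by
  unfold μ; infer_instance

theorem measurable_k_left (y : S.D) : Measurable fun x => S.k x y :=
  S.measurable_k.comp (measurable_id.prodMk measurable_const)

theorem measurable_k_right (x : S.D) : Measurable fun y => S.k x y :=
  S.measurable_k.comp (measurable_const.prodMk measurable_id)

theorem measurable_diag : Measurable fun x => S.k x x :=
  S.measurable_k.comp (measurable_id.prodMk measurable_id)

theorem measurable_kProd_left (u : Finset ℕ+) (y : S.Pt) : Measurable fun x => S.kProd u x y :=
  Finset.measurable_prod _ fun j _ => (S.measurable_k_left _).comp (measurable_pi_apply j)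

theorem measurable_kProd_diag (u : Finset ℕ+) : Measurable fun x => S.kProd u x x :=
  Finset.measurable_prod _ fun j _ => S.measurable_diag.comp (measurable_pi_apply j)

theorem integrable_k_right (x : S.D) : Integrable (fun y => S.k x y) S.ρ :=
  ((integrable_const (S.k x x)).add S.integrable_diag).mono'
    (S.measurable_k_right x).aestronglyMeasurable
    (ae_of_all _ fun y => S.isKernel_k.abs_le x y)

/-- The function `t ↦ ∫ k(t, y) ρ(dy)`. -/
noncomputable def mean (t : S.D) : ℝ := ∫ y, S.k t y ∂S.ρ

theorem abs_mean_le (t : S.D) : |S.mean t| ≤ S.k t t + ∫ y, S.k y y ∂S.ρ := by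
  refine (norm_integral_le_integral_norm (μ := S.ρ) fun y => S.k t y).trans ?_
  have h : ∫ y, (S.k t t + S.k y y) ∂S.ρ = S.k t t + ∫ y, S.k y y ∂S.ρ := by
    rw [integral_add (integrable_const _) S.integrable_diag]; simp
  rw [← h]
  exact integral_mono (S.integrable_k_right t).norm ((integrable_const _).add S.integrable_diag)
    fun y => S.isKernel_k.abs_le t y

theorem integrable_mean : Integrable S.mean S.ρ :=
  (S.integrable_diag.add (integrable_const _)).mono'
    (S.measurable_k.stronglyMeasurable.integral_prod_right (ν := S.ρ)).aestronglyMeasurable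
    (ae_of_all _ S.abs_mean_le)

theorem C₀_eq : S.C₀ = ∫ t, S.mean t ∂S.ρ := rfl

/-- The factor `2` is crude but harmless: only powers with exponent at most `σ` are needed. -/
theorem C₀_le : S.C₀ ≤ 2 * ∫ x, S.k x x ∂S.ρ := by
  have h := integral_mono S.integrable_mean
    (S.integrable_diag.add (integrable_const (∫ y, S.k y y ∂S.ρ)))
    fun t => (le_abs_self _).trans (S.abs_mean_le t)
  rw [integral_add' S.integrable_diag (integrable_const _)] at h
  rw [C₀_eq, two_mul]
  simpa using h

theorem integral_kProd_right (u : Finset ℕ+) (x : S.Pt) :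
    ∫ y, S.kProd u x y ∂S.μ = ∏ j ∈ u, S.mean (x j) :=
  integral_prod_infinitePi (g := fun j t => S.k (x j) t) (fun _ => S.integrable_k_right _) u

theorem integral_prod_mean (u : Finset ℕ+) :
    ∫ x, ∏ j ∈ u, S.mean (x j) ∂S.μ = S.C₀ ^ u.card := by
  rw [μ, integral_prod_infinitePi (g := fun _ => S.mean) (fun _ => S.integrable_mean) u,
    Finset.prod_const, C₀_eq]

theorem integrable_kProd_diag (u : Finset ℕ+) : Integrable (fun x => S.kProd u x x) S.μ :=
  integrable_prod_infinitePi (g := fun _ t => S.k t t) (fun _ => S.integrable_diag) u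

theorem integral_kProd_diag (u : Finset ℕ+) :
    ∫ x, S.kProd u x x ∂S.μ = (∫ x, S.k x x ∂S.ρ) ^ u.card := by
  rw [← Finset.prod_const]
  exact integral_prod_infinitePi (g := fun _ t => S.k t t) (fun _ => S.integrable_diag) u

theorem mem_domain_iff (x : S.Pt) :
    x ∈ S.domain ↔ ∑' u, ENNReal.ofReal (S.γ u * S.kProd u x x) < ⊤ := by
  have h0 : ∀ u, 0 ≤ S.γ u * S.kProd u x x := fun u =>
    mul_nonneg (S.γ_nonneg u) (S.kProd_diag_nonneg u x)
  rw [lt_top_iff_ne_top]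
  refine ⟨fun h => h.tsum_ofReal_ne_top, fun h => ?_⟩
  have := ENNReal.summable_toReal h
  simp only [ENNReal.toReal_ofReal (h0 _)] at this
  exact this

theorem measurable_tsum_diag :
    Measurable fun x => ∑' u, ENNReal.ofReal (S.γ u * S.kProd u x x) :=
  Measurable.tsum fun u => ((S.measurable_kProd_diag u).const_mul _).ennreal_ofReal

theorem measurableSet_domain : MeasurableSet S.domain := by
  have : S.domain = {x | ∑' u, ENNReal.ofReal (S.γ u * S.kProd u x x) < ⊤} :=
    Set.ext S.mem_domain_iff
  rw [this]
  exact measurableSet_lt S.measurable_tsum_diag measurable_const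

/-- The diagonal series has integral `∑ γ_u M^|u| < ∞`, hence is finite almost everywhere. -/
theorem ae_mem_domain : ∀ᵐ x ∂S.μ, x ∈ S.domain := by
  simp only [mem_domain_iff]
  refine ae_lt_top S.measurable_tsum_diag ?_
  rw [lintegral_tsum fun u => ((S.measurable_kProd_diag u).const_mul _).ennreal_ofReal.aemeasurable]
  have h : ∀ u, ∫⁻ x, ENNReal.ofReal (S.γ u * S.kProd u x x) ∂S.μ =
      ENNReal.ofReal (S.γ u * (∫ x, S.k x x ∂S.ρ) ^ u.card) := fun u => by
    rw [← ofReal_integral_eq_lintegral_ofReal ((S.integrable_kProd_diag u).const_mul _)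
      (ae_of_all _ fun x => mul_nonneg (S.γ_nonneg u) (S.kProd_diag_nonneg u x)),
      integral_const_mul, integral_kProd_diag]
  simp only [h]
  exact S.summable_γ.tsum_ofReal_ne_top

theorem restrict_μ_domain : S.μ.restrict S.domain = S.μ :=
  Measure.restrict_eq_self_of_ae_mem S.ae_mem_domain

theorem extend_of_mem (f : S.Hγ) (x : S.domain) : S.extend f x = toFun f x := by
  simp [extend]

theorem functional_extend (f : S.Hγ) (g : S.Pt → ℝ) (h : ∀ x : S.domain, toFun f x = g x) :
    S.nested.functional (S.extend f) = ∫ x, g x ∂S.μ := by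
  have hr : ∫ x in S.domain, g x ∂S.μ = ∫ x, g x ∂S.μ := by rw [S.restrict_μ_domain]
  rw [← hr]
  refine setIntegral_congr_fun S.measurableSet_domain fun x hx => ?_
  exact (S.extend_of_mem f ⟨x, hx⟩).trans (h ⟨x, hx⟩)

theorem measurable_toFun_Hγ (f : S.Hγ) : Measurable (toFun f) :=
  measurable_toFun (hK := S.isKernel_Kγ) (fun y : S.domain =>
    Measurable.tsum (f := fun u (x : S.domain) => S.γ u * S.kProd u x y) fun u => ((S.measurable_kProd_left u y).comp measurable_subtype_coe).const_mul _) f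

theorem measurable_projDomain (v : Finset ℕ+) : Measurable (S.projDomain v) := by
  refine Measurable.subtype_mk (measurable_pi_lambda _ fun j => ?_)
  by_cases hj : j ∈ v
  · simpa [proj, hj] using measurable_pi_apply j
  · simp [proj, hj]

theorem measurable_inner_component (u : Finset ℕ+) (g : S.Hγ) :
    Measurable fun y => inner ℝ (S.component u y) g := by
  simp only [inner_component]
  exact Finset.measurable_sum _ fun v _ =>
    ((S.measurable_toFun_Hγ g).comp (S.measurable_projDomain v)).const_mul _

/-- The elementary `t ≤ 1 + t²` replaces the norm by an integrable bound. -/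
theorem norm_component_le (u : Finset ℕ+) (y : S.Pt) :
    ‖S.component u y‖ ≤ 1 + S.γ u * S.kProd u y y := by
  rw [← norm_component_sq]
  nlinarith [sq_nonneg (‖S.component u y‖ - 1)]

theorem integrable_inner_component (u : Finset ℕ+) (g : S.Hγ) :
    Integrable (fun y => inner ℝ (S.component u y) g) S.μ := by
  refine (((integrable_const 1).add ((S.integrable_kProd_diag u).const_mul (S.γ u))).mul_const
    ‖g‖).mono' (S.measurable_inner_component u g).aestronglyMeasurable (ae_of_all _ fun y => ?_)
  exact (norm_inner_le_norm _ _).trans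
    (mul_le_mul_of_nonneg_right (S.norm_component_le u y) (norm_nonneg _))

/-- The weak integral of `γ_u k_u(·, y)` with respect to `μ(dy)`. -/
theorem exists_representer (u : Finset ℕ+) :
    ∃ h : S.Hγ, ∀ g : S.Hγ, inner ℝ h g = ∫ y, inner ℝ (S.component u y) g ∂S.μ := by
  let L : S.Hγ →ₗ[ℝ] ℝ :=
    { toFun := fun g => ∫ y, inner ℝ (S.component u y) g ∂S.μ
      map_add' := fun f g => by
        simp only [inner_add_right]
        exact integral_add (S.integrable_inner_component u f) (S.integrable_inner_component u g)
      map_smul' := fun c f => by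
        simp only [inner_smul_right, RingHom.id_apply, smul_eq_mul]
        exact integral_const_mul _ _ }
  have hL : ∀ g, ‖L g‖ ≤ (∫ y, (1 + S.γ u * S.kProd u y y) ∂S.μ) * ‖g‖ := fun g => by
    refine (norm_integral_le_integral_norm _).trans ?_
    rw [← integral_mul_const]
    refine integral_mono (S.integrable_inner_component u g).norm
      (((integrable_const 1).add ((S.integrable_kProd_diag u).const_mul (S.γ u))).mul_const ‖g‖)
      fun y => ?_
    exact (norm_inner_le_norm _ _).trans
      (mul_le_mul_of_nonneg_right (S.norm_component_le u y) (norm_nonneg _))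
  refine ⟨(InnerProductSpace.toDual ℝ S.Hγ).symm (L.mkContinuous _ hL), fun g => ?_⟩
  rw [InnerProductSpace.toDual_symm_apply]
  rfl

/-- The representer of integration on the component space with index `u`. -/
noncomputable def representer (u : Finset ℕ+) : S.Hγ := (S.exists_representer u).choose

theorem inner_representer (u : Finset ℕ+) (g : S.Hγ) :
    inner ℝ (S.representer u) g = ∫ y, inner ℝ (S.component u y) g ∂S.μ :=
  (S.exists_representer u).choose_spec g

theorem toFun_representer (u : Finset ℕ+) (x : S.domain) :
    toFun (S.representer u) x = S.γ u * ∏ j ∈ u, S.mean ((x : S.Pt) j) := by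
  rw [← inner_kfun, real_inner_comm, inner_representer, ← integral_kProd_right,
    ← integral_const_mul]
  refine integral_congr_ae (ae_of_all _ fun y => ?_)
  change inner ℝ (S.component u y) _ = _
  rw [real_inner_comm, inner_kfun, toFun_component]

/-- Representers inherit orthogonality from the components. Integrating `γ_u k_u` in both arguments
gives the squared norm `γ_u C₀^|u|`, which is why the weights `γ̂_u` appear. -/
theorem inner_representer_representer (u w : Finset ℕ+) :
    inner ℝ (S.representer u) (S.representer w) =
      if u = w then S.γ u * S.C₀ ^ u.card else 0 := by
  have h1 : ∀ y, inner ℝ (S.component u y) (S.representer w) =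
      if u = w then S.γ u * ∏ j ∈ u, S.mean (y j) else 0 := fun y => by
    rw [real_inner_comm, inner_representer]
    simp only [inner_component_component]
    split_ifs with h
    · rw [← integral_kProd_right, ← integral_const_mul]
      simp only [S.kProd_symm u y]
    · simp
  rw [inner_representer]
  simp only [h1]
  split_ifs with h
  · rw [integral_const_mul, integral_prod_mean]
  · simp

theorem toFun_representer_eq_zero {u v : Finset ℕ+} (huv : ¬u ⊆ v) {x : S.domain}
    (hx : (x : S.Pt) ∈ S.subspace v) : toFun (S.representer u) x = 0 := by
  rw [toFun_representer, ← integral_kProd_right]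
  simp [S.kProd_eq_zero_of_mem_subspace huv hx]

/-- On the unit ball of the span of components `u ∈ F`, integration attains the norm
`(∑_{u ∈ F} γ_u C₀^|u|)^(1/2)`. -/
theorem exists_extremal {F : Finset (Finset ℕ+)} {v : Finset ℕ+} (hF : ∀ u ∈ F, ¬u ⊆ v) :
    ∃ f : S.Hγ, ‖f‖ ≤ 1 ∧ (∀ x ∈ S.subspace v, S.extend f x = 0) ∧
      S.nested.functional (S.extend f) ^ 2 = ∑ u ∈ F, S.γ u * S.C₀ ^ u.card := by
  set B := ∑ u ∈ F, S.γ u * S.C₀ ^ u.card with hB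
  have hC : 0 < S.C₀ := S.C₀_pos
  have hB0 : 0 ≤ B := Finset.sum_nonneg fun u _ => mul_nonneg (S.γ_nonneg u) (by positivity)
  -- The sum `g` satisfies `‖g‖² = I(g) = B`, so `g / √B` has integral `√B`. If `B = 0`, the inverse
  -- is `0` and the zero function serves.
  set g : S.Hγ := ∑ u ∈ F, S.representer u with hg
  have hnorm : ‖g‖ ^ 2 = B := by
    rw [← real_inner_self_eq_norm_sq, hg, sum_inner]
    simp only [inner_sum, inner_representer_representer]
    refine Finset.sum_congr rfl fun u hu => ?_
    simp [hu]
  have hfun : ∀ x : S.domain, toFun g x = ∑ u ∈ F, S.γ u * ∏ j ∈ u, S.mean ((x : S.Pt) j) :=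
    fun x => by rw [hg, toFun_sum]; simp only [toFun_representer]
  have hint : ∫ x : S.Pt, ∑ u ∈ F, S.γ u * ∏ j ∈ u, S.mean (x j) ∂S.μ = B := by
    rw [integral_finsetSum]
    · simp only [integral_const_mul, integral_prod_mean, hB]
    · exact fun u _ => (integrable_prod_infinitePi (g := fun _ => S.mean)
        (fun _ => S.integrable_mean) u).const_mul _
  have hg0 : ∀ x ∈ S.subspace v, S.extend g x = 0 := fun x hx => by
    have hxd := S.subspace_subset_domain v hx
    rw [S.extend_of_mem g ⟨x, hxd⟩, hg, toFun_sum]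
    exact Finset.sum_eq_zero fun u hu => S.toFun_representer_eq_zero (hF u hu) hx
  have hgn : ‖g‖ = √B := by rw [← hnorm, Real.sqrt_sq (norm_nonneg _)]
  refine ⟨(√B)⁻¹ • g, ?_, fun x hx => ?_, ?_⟩
  · rw [norm_smul, norm_inv, Real.norm_of_nonneg (Real.sqrt_nonneg _), hgn]
    exact inv_mul_le_one
  · have hxd := S.subspace_subset_domain v hx
    have := hg0 x hx
    rw [S.extend_of_mem _ ⟨x, hxd⟩] at this ⊢
    rw [toFun_smul, this, mul_zero]
  · rw [S.functional_extend _ (fun x => (√B)⁻¹ * ∑ u ∈ F, S.γ u * ∏ j ∈ u, S.mean (x j))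
      (fun x => by rw [toFun_smul, hfun]), integral_const_mul, hint]
    rcases hB0.eq_or_lt with h | h
    · simp [← h]
    · rw [mul_pow, inv_pow, Real.sq_sqrt hB0]
      field_simp

end Setting

end NestedSampling

namespace NestedSampling

/-! ### Lower error bounds from unseen components -/

namespace RandAlg

variable {X : Type} (A : RandAlg X)

/-- By induction, an adaptive algorithm follows the same path on two functions that agree at the
points it uses for one of them. -/
theorem transcript_congr {f g : X → ℝ} {ω : A.Ω}
    (h : ∀ n x, A.point f ω n = some x → g x = f x) (n : ℕ) :
    A.transcript g ω n = A.transcript f ω n := by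
  induction n with
  | zero => rfl
  | succ n ih =>
    have hp := h n
    simp only [point] at hp
    simp only [transcript, ih]
    cases hq : A.query ω (A.transcript f ω n) with
    | none => rfl
    | some x => simp [hp x hq]

theorem result_congr {f g : X → ℝ} {ω : A.Ω}
    (h : ∀ n x, A.point f ω n = some x → g x = f x) :
    A.result g ω = A.result f ω := by
  have ht : A.transcript g ω = A.transcript f ω := funext (A.transcript_congr h)
  unfold result point
  rw [ht]

theorem le_cost_of_point_eq_some {c : X → ℝ≥0∞} {f : X → ℝ} {ω : A.Ω} {n : ℕ} {x : X}
    (h : A.point f ω n = some x) : c x ≤ A.cost c f ω := by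
  have := ENNReal.le_tsum (f := fun n => (A.point f ω n).elim 0 c) n
  rw [h] at this
  exact this

end RandAlg

namespace Problem

variable {X : Type} (T : Problem X)

theorem error_sq (A : RandAlg X) : T.error A ^ 2 =
    ⨆ f ∈ T.ball, ∫⁻ ω, ENNReal.ofReal ((T.functional f - A.result f ω) ^ 2) ∂A.P := by
  rw [error, ← ENNReal.rpow_natCast, ← ENNReal.rpow_mul]
  norm_num

/-- If an algorithm cannot distinguish `f` and `g` with `I(g) = -I(f)` whenever its cost for `f`
is at most twice a bound for the expected cost, then `I(f)²` is at most twice its squared error. -/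
theorem functional_sq_le {A : RandAlg X} (hA : T.IsAdmissible A) {c : X → ℝ≥0∞}
    (hc : c ∈ T.costs) {f g : X → ℝ} (hfs : f ∈ T.space) (hf : f ∈ T.ball) (hg : g ∈ T.ball)
    (hfg : T.functional g = -T.functional f) {N : ℝ} (hN : 0 < N)
    (hcost : ∫⁻ ω, A.cost c f ω ∂A.P ≤ ENNReal.ofReal N)
    (hres : ∀ ω, A.cost c f ω ≤ ENNReal.ofReal (2 * N) → A.result g ω = A.result f ω) :
    ENNReal.ofReal (T.functional f ^ 2) ≤ 2 * T.error A ^ 2 := by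
  set I := T.functional f with hI
  have hcm : Measurable (A.cost c f) := (hA f hfs).2 c hc
  have hrm : Measurable (A.result f) := (hA f hfs).1.1
  set E : Set A.Ω := {ω | A.cost c f ω ≤ ENNReal.ofReal (2 * N)} with hE
  have hEm : MeasurableSet E := measurableSet_le hcm measurable_const
  have h2N : ENNReal.ofReal (2 * N) = 2 * ENNReal.ofReal N := by
    rw [ENNReal.ofReal_mul (by norm_num)]; simp
  have hN0 : ENNReal.ofReal N ≠ 0 := by simpa using hN
  -- Markov's inequality at twice the bound on the mean.
  have hEc : A.P Eᶜ ≤ 2⁻¹ := by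
    have h1 : A.P Eᶜ ≤ A.P {ω | ENNReal.ofReal (2 * N) ≤ A.cost c f ω} :=
      measure_mono fun ω (hω : ¬A.cost c f ω ≤ _) => (not_le.1 hω).le
    have h2 := mul_meas_ge_le_lintegral hcm (μ := A.P) (ENNReal.ofReal (2 * N))
    have h3 := (mul_le_mul_right h1 (ENNReal.ofReal (2 * N))).trans (h2.trans hcost)
    rw [h2N, mul_comm (2 : ℝ≥0∞), mul_assoc] at h3
    nth_rewrite 2 [← mul_one (ENNReal.ofReal N)] at h3
    rw [ENNReal.mul_le_mul_iff_right hN0 ENNReal.ofReal_ne_top] at h3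
    rw [ENNReal.le_inv_iff_mul_le, mul_comm]
    exact h3
  have hEp : 2⁻¹ ≤ A.P E := by
    have h1 := prob_add_prob_compl (μ := A.P) hEm
    by_contra! h
    have h2 := ENNReal.add_lt_add_of_lt_of_le (measure_ne_top A.P Eᶜ) h hEc
    rw [h1, ENNReal.inv_two_add_inv_two] at h2
    exact lt_irrefl _ h2
  have e1 : ∫⁻ ω in E, ENNReal.ofReal ((I - A.result f ω) ^ 2) ∂A.P ≤ T.error A ^ 2 := by
    rw [error_sq]
    exact (setLIntegral_le_lintegral _ _).trans (le_iSup₂_of_le f hf le_rfl)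
  have e2 : ∫⁻ ω in E, ENNReal.ofReal ((I + A.result f ω) ^ 2) ∂A.P ≤ T.error A ^ 2 := by
    rw [error_sq]
    refine le_trans (le_of_eq ?_)
      ((setLIntegral_le_lintegral E _).trans (le_iSup₂_of_le g hg le_rfl))
    refine setLIntegral_congr_fun hEm fun ω hω => ?_
    simp only [hfg, hres ω hω]
    congr 1
    ring
  -- On `E` the same output has to approximate both `I` and `-I`, and `(I - q)² + (I + q)² ≥ 2I²`.
  -- The factor `2` offsets `P(E) ≥ 1/2`.
  have e3 : ENNReal.ofReal (I ^ 2) ≤ ∫⁻ ω in E, (ENNReal.ofReal ((I - A.result f ω) ^ 2) +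
      ENNReal.ofReal ((I + A.result f ω) ^ 2)) ∂A.P := by
    calc ENNReal.ofReal (I ^ 2) = ENNReal.ofReal (2 * I ^ 2) * 2⁻¹ := by
          rw [ENNReal.ofReal_mul (by norm_num), mul_comm, ← mul_assoc]
          simp [ENNReal.inv_mul_cancel]
      _ ≤ ENNReal.ofReal (2 * I ^ 2) * A.P E := by gcongr
      _ = ∫⁻ ω in E, ENNReal.ofReal (2 * I ^ 2) ∂A.P := by simp
      _ ≤ _ := by
          refine lintegral_mono fun ω => ?_
          rw [← ENNReal.ofReal_add (sq_nonneg _) (sq_nonneg _)]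
          exact ENNReal.ofReal_le_ofReal (by nlinarith [sq_nonneg (A.result f ω)])
  have hm : Measurable fun ω => ENNReal.ofReal ((I - A.result f ω) ^ 2) := by fun_prop
  rw [lintegral_add_left hm] at e3
  exact e3.trans ((add_le_add e1 e2).trans (two_mul _).ge)

end Problem

/-! ### Nested costs: cheap evaluations see few coordinates -/

namespace Setting

variable (S : Setting)

theorem subspace_mono {u v : Finset ℕ+} (h : u ⊆ v) : S.subspace u ⊆ S.subspace v :=
  fun _ hx j hj => hx j fun hju => hj (h hju)

/-- If evaluations with `ν` active variables cost at least a multiple of `ν ^ s`, then evaluations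
of cost at most `2N` only use a set of `O(N ^ (1/s))` coordinates. -/
theorem exists_cover {s : ℝ} (hs : 0 < s)
    (hprice : ∃ c : ℝ, 0 < c ∧
      ∀ᶠ ν : ℕ in atTop, ENNReal.ofReal (c * (ν : ℝ) ^ s) ≤ S.price ν) :
    ∃ C : ℝ, 0 < C ∧ ∀ v : ℕ → Finset ℕ+, StrictMono v → ∀ N : ℝ, 1 ≤ N →
      ∃ V : Finset ℕ+, (V.card : ℝ) ≤ C * N ^ (1 / s) ∧
        ∀ x, S.nestedCost v x ≤ ENNReal.ofReal (2 * N) → x ∈ S.subspace V := by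
  obtain ⟨c, hc, hev⟩ := hprice
  obtain ⟨ν₀, hν⟩ := eventually_atTop.1 hev
  -- The term `ν₀` covers cardinalities below the range of the price bound. The other solves `c ν^s
  -- < 3N`, where `3N > 2N` gives the strict inequality needed to pick an index from the infimum.
  refine ⟨max ν₀ ((3 / c) ^ (1 / s)), lt_max_of_lt_right (by positivity), fun v hv N hN => ?_⟩
  have hN0 : 0 < N := by linarith
  set R := max (ν₀ : ℝ) ((3 / c) ^ (1 / s)) * N ^ (1 / s) with hR
  have hcard : ∀ i, S.price (v i).card < ENNReal.ofReal (3 * N) → ((v i).card : ℝ) ≤ R := by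
    intro i hi
    rcases le_total (v i).card ν₀ with h | h
    · calc ((v i).card : ℝ) ≤ ν₀ := by exact_mod_cast h
        _ ≤ max (ν₀ : ℝ) ((3 / c) ^ (1 / s)) * 1 := by rw [mul_one]; exact le_max_left _ _
        _ ≤ R := mul_le_mul_of_nonneg_left (Real.one_le_rpow hN (by positivity)) (by positivity)
    · have h1 := (hν _ h).trans_lt hi
      rw [ENNReal.ofReal_lt_ofReal_iff (by positivity)] at h1
      have h2 : ((v i).card : ℝ) ^ s ≤ 3 / c * N := by
        rw [div_mul_eq_mul_div, le_div_iff₀ hc]; linarith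
      calc ((v i).card : ℝ) = (((v i).card : ℝ) ^ s) ^ (1 / s) := by
            rw [← Real.rpow_mul (by positivity), mul_one_div_cancel hs.ne', Real.rpow_one]
        _ ≤ (3 / c * N) ^ (1 / s) := by gcongr
        _ = (3 / c) ^ (1 / s) * N ^ (1 / s) := Real.mul_rpow (by positivity) (by positivity)
        _ ≤ R := mul_le_mul_of_nonneg_right (le_max_right _ _) (by positivity)
  -- Strictly increasing sets have strictly increasing cardinalities, so only finitely many indices
  -- are affordable, and the largest one yields `V`.
  have hi : ∀ i, i ≤ (v i).card :=
    (StrictMono.id_le (f := fun i => (v i).card) fun i j hij => Finset.card_lt_card (hv hij))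
  have hmem : ∀ x, S.nestedCost v x ≤ ENNReal.ofReal (2 * N) →
      ∃ i, x ∈ S.subspace (v i) ∧ S.price (v i).card < ENNReal.ofReal (3 * N) := by
    intro x hx
    have h := hx.trans_lt ((ENNReal.ofReal_lt_ofReal_iff (q := 3 * N) (by positivity)).2
      (by linarith))
    rw [nestedCost, iInf_lt_iff] at h
    obtain ⟨i, hi⟩ := h
    rw [iInf_lt_iff] at hi
    exact ⟨i, hi.choose, hi.choose_spec⟩
  set P : Set ℕ := {i | S.price (v i).card < ENNReal.ofReal (3 * N)} with hP
  by_cases hne : P.Nonempty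
  · have hbdd : BddAbove P := ⟨⌊R⌋₊, fun i hiP => Nat.le_floor
      ((Nat.cast_le.2 (hi i)).trans (hcard i hiP))⟩
    refine ⟨v (sSup P), hcard _ (Nat.sSup_mem hne hbdd), fun x hx => ?_⟩
    obtain ⟨i, hxi, hiP⟩ := hmem x hx
    exact S.subspace_mono (hv.monotone (le_csSup hbdd hiP)) hxi
  · refine ⟨∅, by simp only [Finset.card_empty, Nat.cast_zero]; positivity, fun x hx => ?_⟩
    obtain ⟨i, -, hiP⟩ := hmem x hx
    exact absurd ⟨i, hiP⟩ hne

theorem extend_neg (f : S.Hγ) (x : S.Pt) : S.extend (-f) x = -S.extend f x := by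
  unfold extend
  split_ifs
  · exact toFun_neg f _
  · simp

theorem functional_neg (f : S.Hγ) :
    S.nested.functional (S.extend (-f)) = -S.nested.functional (S.extend f) := by
  simp only [nested, extend_neg, integral_neg]

/-- An algorithm of small cost does not see the components `γ_u k_u` with `u ⊈ V` for a set `V` of
few coordinates. -/
theorem exists_unseen {s : ℝ} (hs : 0 < s)
    (hprice : ∃ c : ℝ, 0 < c ∧
      ∀ᶠ ν : ℕ in atTop, ENNReal.ofReal (c * (ν : ℝ) ^ s) ≤ S.price ν) :
    ∃ C : ℝ, 0 < C ∧ ∀ A : RandAlg S.Pt, S.nested.IsAdmissible A → ∀ N : ℝ, 1 ≤ N →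
      S.nested.worstCost A < ENNReal.ofReal N →
      ∃ V : Finset ℕ+, (V.card : ℝ) ≤ C * N ^ (1 / s) ∧
        ∀ F : Finset (Finset ℕ+), (∀ u ∈ F, ¬u ⊆ V) →
          ENNReal.ofReal (∑ u ∈ F, S.γ u * S.C₀ ^ u.card) ≤ 2 * S.nested.error A ^ 2 := by
  obtain ⟨C, hC, hcov⟩ := S.exists_cover hs hprice
  refine ⟨C, hC, fun A hA N hN hcost => ?_⟩
  rw [Problem.worstCost, iInf_lt_iff] at hcost
  obtain ⟨c, hcost⟩ := hcost
  rw [iInf_lt_iff] at hcost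
  obtain ⟨hc, hcost⟩ := hcost
  obtain ⟨v, hv, -, rfl⟩ := id hc
  obtain ⟨V, hV, hVs⟩ := hcov v hv N hN
  refine ⟨V, hV, fun F hF => ?_⟩
  obtain ⟨f, hf1, hf0, hfI⟩ := S.exists_extremal hF
  rw [← hfI]
  have hball : S.extend f ∈ S.nested.ball := ⟨f, hf1, rfl⟩
  -- The fooling pair is `f` and `-f`: both vanish at every point used when the cost for `f` is at
  -- most `2N`.
  refine S.nested.functional_sq_le hA hc (g := S.extend (-f)) ⟨f, rfl⟩ hball
    ⟨-f, by rwa [norm_neg], rfl⟩ (S.functional_neg f) (by linarith : 0 < N)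
    ((le_iSup₂_of_le (f := fun f _ => ∫⁻ ω, A.cost (S.nestedCost v) f ω ∂A.P) _ hball
      le_rfl).trans hcost.le) fun ω hω => A.result_congr fun n x hx => ?_
  rw [S.extend_neg, hf0 x (hVs x ((A.le_cost_of_point_eq_some hx).trans hω)), neg_zero]

end Setting

end NestedSampling

namespace NestedSampling

/-! ### Decay of the weights -/

/-- A countable set can be enumerated in the order of decreasing weights if only finitely many
elements exceed a given one. -/
theorem exists_antitone_enumeration {ι : Type*} [Countable ι] [Nonempty ι] (S : Set ι) (w : ι → ℝ)
    (hfin : ∀ u ∈ S, {x | x ∈ S ∧ w u ≤ w x}.Finite) :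
    ∃ e : ℕ → ι, Set.BijOn e {j : ℕ | (j : ℕ∞) < S.encard} S ∧
      AntitoneOn (fun j => w (e j)) {j : ℕ | (j : ℕ∞) < S.encard} := by
  obtain ⟨enc, henc⟩ := exists_injective_nat ι
  -- Ties between equal weights are broken by an injective code. Each element of `S` then has
  -- finitely many predecessors, and their number is its position.
  let key : ι → ℝᵒᵈ ×ₗ ℕ := fun u => toLex (OrderDual.toDual (w u), enc u)
  have hkey : Function.Injective key := fun x y h => henc (congrArg (fun p => (ofLex p).2) h)
  let B : ι → Set ι := fun u => {x | x ∈ S ∧ key x < key u}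
  have hlt : ∀ {x u}, w u < w x → key x < key u := fun {x u} h => by
    rw [Prod.Lex.lt_iff]; exact Or.inl h
  have hle : ∀ {x u}, key x < key u → w u ≤ w x := fun {x u} h => by
    by_contra! h'
    exact lt_asymm h (hlt h')
  have hB : ∀ u ∈ S, (B u).Finite := fun u hu =>
    (hfin u hu).subset fun x hx => ⟨hx.1, hle hx.2⟩
  let rank : ι → ℕ := fun u => (B u).ncard
  have hrank : ∀ x ∈ S, ∀ u ∈ S, key x < key u → rank x < rank u := fun x hx u hu h =>
    Set.ncard_lt_ncard ⟨fun y hy => ⟨hy.1, hy.2.trans h⟩,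
      fun hs => lt_irrefl _ (hs ⟨hx, h⟩ : x ∈ B x).2⟩ (hB u hu)
  have hinj : Set.InjOn rank S := fun x hx u hu h => by
    by_contra hne
    rcases lt_or_gt_of_ne (hkey.ne hne) with h' | h'
    · exact (hrank x hx u hu h').ne h
    · exact (hrank u hu x hx h').ne h.symm
  -- No position is skipped: `rank` maps the `rank u` predecessors of `u` injectively into the
  -- numbers below `rank u`.
  have hlower : ∀ u ∈ S, ∀ n < rank u, ∃ x ∈ S, rank x = n := by
    intro u hu n hn
    have hsub : rank '' B u = Set.Iio (rank u) := by
      refine Set.eq_of_subset_of_ncard_le ?_ ?_ (Set.finite_Iio _)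
      · rintro _ ⟨x, hx, rfl⟩
        exact hrank x hx.1 u hu hx.2
      · rw [(hinj.mono fun x (hx : x ∈ B u) => hx.1).ncard_image, Set.ncard_Iio_nat]
    obtain ⟨x, hx, hxn⟩ := hsub.ge (Set.mem_Iio.2 hn)
    exact ⟨x, hx.1, hxn⟩
  have himage : rank '' S = {j : ℕ | (j : ℕ∞) < S.encard} := by
    rw [← hinj.encard_image]
    ext j
    refine ⟨?_, fun hj => ?_⟩
    · rintro ⟨u, hu, rfl⟩
      have hs : Set.Iio (rank u + 1) ⊆ rank '' S := fun n hn => by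
        rcases (Nat.lt_succ_iff.1 hn).eq_or_lt with h | h
        · exact ⟨u, hu, h.symm⟩
        · exact hlower u hu n h
      have h := Set.encard_le_encard hs
      rw [← (Set.finite_Iio _).cast_ncard_eq, Set.ncard_Iio_nat] at h
      exact lt_of_lt_of_le (by exact_mod_cast Nat.lt_succ_self _) h
    · by_contra hn
      have hs : rank '' S ⊆ Set.Iio j := by
        rintro _ ⟨u, hu, rfl⟩
        change rank u < j
        by_contra h
        rcases (not_lt.1 h).eq_or_lt with h | h
        · exact hn ⟨u, hu, h.symm⟩
        · exact hn (hlower u hu j h)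
      have h := Set.encard_le_encard hs
      rw [← (Set.finite_Iio _).cast_ncard_eq, Set.ncard_Iio_nat] at h
      exact lt_irrefl _ (lt_of_lt_of_le hj h)
  have hbij : Set.BijOn rank S {j : ℕ | (j : ℕ∞) < S.encard} := himage ▸ hinj.bijOn_image
  have hinv := hbij.invOn_invFunOn
  have hbij' := hbij.symm hinv.symm
  refine ⟨Function.invFunOn rank S, hbij', fun i hi j hj hij => ?_⟩
  by_contra! h
  have h' := hrank _ (hbij'.mapsTo hj) _ (hbij'.mapsTo hi) (hlt h)
  rw [hinv.2 hi, hinv.2 hj] at h'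
  omega

namespace Setting

variable (S : Setting)

theorem cutoffHat_of_mem {σ : ℕ} {u : Finset ℕ+} (hu : u ∈ S.support σ) :
    S.cutoffHat σ u = S.γ u * S.C₀ ^ u.card := by
  have h := hu.2
  unfold cutoff at h
  split_ifs at h with hc
  · simp [cutoffHat, cutoff, hc]
  · exact absurd h (lt_irrefl _)

/-- Since `C₀ ≤ 2M` and only `|u| ≤ σ` counts, `2^σ γ_u M^|u|` is a summable majorant. -/
theorem summable_cutoffHat (σ : ℕ) : Summable (S.cutoffHat σ) := by
  have hC : 0 < S.C₀ := S.C₀_pos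
  have hCM := S.C₀_le
  refine Summable.of_nonneg_of_le (fun u => ?_) (fun u => ?_) (S.summable_γ.mul_left (2 ^ σ))
  · unfold cutoffHat cutoff
    split_ifs
    · exact mul_nonneg (S.γ_nonneg u) (by positivity)
    · simp
  · have hM : 0 ≤ ∫ x, S.k x x ∂S.ρ := integral_nonneg fun x => S.isKernel_k.diag_nonneg x
    unfold cutoffHat cutoff
    split_ifs with hu
    · have h1 : S.C₀ ^ u.card ≤ 2 ^ σ * (∫ x, S.k x x ∂S.ρ) ^ u.card :=
        calc S.C₀ ^ u.card ≤ (2 * ∫ x, S.k x x ∂S.ρ) ^ u.card := by gcongr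
          _ = 2 ^ u.card * (∫ x, S.k x x ∂S.ρ) ^ u.card := mul_pow _ _ _
          _ ≤ 2 ^ σ * (∫ x, S.k x x ∂S.ρ) ^ u.card := by gcongr; norm_num
      nlinarith [mul_le_mul_of_nonneg_left h1 (S.γ_nonneg u)]
    · rw [zero_mul]
      have := S.γ_nonneg u
      positivity

/-- Summable weights tend to `0`, so only finitely many are at least a given positive one. -/
theorem exists_isOrderedEnum (σ : ℕ) : ∃ e, S.IsOrderedEnum σ e := by
  refine exists_antitone_enumeration (S.support σ) (S.cutoffHat σ) fun u hu => ?_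
  have hC : 0 < S.C₀ := S.C₀_pos
  have hpos : 0 < S.cutoffHat σ u := mul_pos hu.2 (by positivity)
  have h := (S.summable_cutoffHat σ).tendsto_cofinite_zero.eventually_lt_const hpos
  rw [eventually_cofinite] at h
  exact h.subset fun x hx => not_lt.2 hx.2

theorem decay_eq_top {σ : ℕ} (h : (S.support σ).Finite) : S.decay σ = ⊤ := by
  obtain ⟨e, he⟩ := S.exists_isOrderedEnum σ
  refine eq_top_iff.2 (EReal.ge_of_forall_gt_iff_ge.1 fun z _ => le_sSup ⟨z, ⟨e, he, ?_⟩, rfl⟩)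
  refine tendsto_const_nhds.congr' ?_
  filter_upwards [eventually_ge_atTop (S.support σ).ncard] with j hj
  rw [if_neg]
  rw [positions, Set.mem_ofPred_eq, ← h.cast_ncard_eq, not_lt]
  exact_mod_cast hj

theorem positions_eq_univ {σ : ℕ} (h : (S.support σ).Infinite) : S.positions σ = Set.univ := by
  simp [positions, h.encard_eq]

/-- Strong polynomial bounds on the complexity force a decay of the weights. -/
theorem le_decay {s : ℝ} (hs : 0 < s)
    (hprice : ∃ c : ℝ, 0 < c ∧
      ∀ᶠ ν : ℕ in atTop, ENNReal.ofReal (c * (ν : ℝ) ^ s) ≤ S.price ν)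
    {C p : ℝ} (hC : 0 ≤ C) (hp : 0 < p)
    (hcomp : ∀ ε : ℝ, 0 < ε → ε < 1 → S.nested.comp ε ≤ ENNReal.ofReal (C * ε ^ (-p)))
    {σ : ℕ} {t Ct : ℝ} (ht : 0 < t) (hCt : 0 < Ct) (hcount : ∀ v : Finset ℕ+,
      (({u | u ∈ S.support σ ∧ u ⊆ v} : Set (Finset ℕ+)).ncard : ℝ) ≤ Ct * (v.card : ℝ) ^ t) :
    ((1 + 2 * s / (p * t) : ℝ) : EReal) ≤ S.decay σ := by
  classical
  by_cases hfin : (S.support σ).Finite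
  · rw [S.decay_eq_top hfin]; exact le_top
  have hpos := S.positions_eq_univ hfin
  obtain ⟨e, he⟩ := S.exists_isOrderedEnum σ
  have he' := he
  rw [IsOrderedEnum, hpos] at he'
  obtain ⟨hbij, hanti⟩ := he'
  have hinj : Function.Injective e := Set.injOn_univ.1 hbij.injOn
  have hmem : ∀ j, e j ∈ S.support σ := fun j => hbij.mapsTo (Set.mem_univ j)
  obtain ⟨C₁, hC₁, hunseen⟩ := S.exists_unseen hs hprice
  -- With `N = (C + 1) ε^(-p)`, at most `D ε^(-pt/s)` of the sets are subsets of `V`. Using `C + 1`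
  -- makes the complexity bound strict and ensures `N ≥ 1`.
  set D := Ct * (C₁ * (C + 1) ^ (1 / s)) ^ t with hD
  have hDpos : 0 < D := by positivity
  set r := s / (p * t) with hr
  have hrpos : 0 < r := by positivity
  have hbound : ∀ j : ℕ, 2 * D < (j : ℝ) + 1 →
      S.cutoffHat σ (e j) ≤ 4 * (2 * D) ^ (2 * r) * ((j : ℝ) + 1) ^ (-(1 + 2 * r)) := by
    intro j hj
    set m : ℝ := (j : ℝ) + 1 with hm
    have hm0 : 0 < m := by positivity
    set b := m / (2 * D) with hb
    have hb1 : 1 < b := by rw [hb, one_lt_div (by positivity)]; exact hj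
    have hb0 : 0 < b := by linarith
    -- The choice makes `D ε^(-pt/s) = D b = m / 2`.
    set ε := b ^ (-r) with hε
    have hε0 : 0 < ε := by positivity
    have hε1 : ε < 1 := Real.rpow_lt_one_of_one_lt_of_neg hb1 (by linarith)
    have hεp : 1 ≤ ε ^ (-p) := (Real.one_lt_rpow_of_pos_of_lt_one_of_neg hε0 hε1 (by linarith)).le
    have hlt : S.nested.comp ε < ENNReal.ofReal ((C + 1) * ε ^ (-p)) :=
      (hcomp ε hε0 hε1).trans_lt
        ((ENNReal.ofReal_lt_ofReal_iff (by positivity)).2 (by nlinarith))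
    simp only [Problem.comp, iInf_lt_iff] at hlt
    obtain ⟨A, hA, herr, hcost⟩ := hlt
    obtain ⟨V, hV, hF⟩ := hunseen A hA _ (by nlinarith) hcost
    have hVt : Ct * (V.card : ℝ) ^ t ≤ m / 2 := by
      calc Ct * (V.card : ℝ) ^ t ≤ Ct * (C₁ * ((C + 1) * ε ^ (-p)) ^ (1 / s)) ^ t := by gcongr
        _ = Ct * (C₁ * (C + 1) ^ (1 / s) * ε ^ (-p / s)) ^ t := by
            rw [Real.mul_rpow (x := C + 1) (by positivity) (by positivity), ← Real.rpow_mul hε0.le,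
              ← mul_assoc, mul_one_div]
        _ = D * (b ^ (-r)) ^ (-p / s * t) := by
            rw [Real.mul_rpow (by positivity) (by positivity), ← Real.rpow_mul hε0.le, ← mul_assoc]
        _ = D * b := by
            rw [← Real.rpow_mul hb0.le]
            have : -r * (-p / s * t) = 1 := by rw [hr]; field_simp
            rw [this, Real.rpow_one]
        _ = m / 2 := by rw [hb]; field_simp
    set G := (Finset.range (j + 1)).filter fun i => e i ⊆ V with hG
    set G' := (Finset.range (j + 1)).filter fun i => ¬e i ⊆ V with hG'
    have hcardG : (G.card : ℝ) ≤ m / 2 := by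
      refine le_trans ?_ ((hcount V).trans hVt)
      rw [← Finset.card_image_of_injective G hinj, ← Set.ncard_coe_finset]
      refine Nat.cast_le.2 (Set.ncard_le_ncard (fun u hu => ?_)
        (V.powerset.finite_toSet.subset fun u hu => Finset.mem_coe.2 (Finset.mem_powerset.2 hu.2)))
      obtain ⟨i, hi, rfl⟩ := Finset.mem_image.1 (Finset.mem_coe.1 hu)
      exact ⟨hmem i, (Finset.mem_filter.1 hi).2⟩
    have hcard : (G.card : ℝ) + G'.card = m := by
      have := Finset.card_filter_add_card_filter_not (s := Finset.range (j + 1)) (fun i => e i ⊆ V)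
      rw [Finset.card_range] at this
      rw [hm]
      exact_mod_cast this
    have hsum := hF (G'.image e) fun u hu => by
      obtain ⟨i, hi, rfl⟩ := Finset.mem_image.1 hu
      exact (Finset.mem_filter.1 hi).2
    rw [Finset.sum_image hinj.injOn] at hsum
    have herr2 : 2 * S.nested.error A ^ 2 ≤ ENNReal.ofReal (2 * ε ^ 2) := by
      rw [ENNReal.ofReal_mul (by norm_num), ENNReal.ofReal_pow hε0.le]
      gcongr
      simp
    have hsum2 := (ENNReal.ofReal_le_ofReal_iff (by positivity)).1 (hsum.trans herr2)
    -- By monotonicity each unseen set among the first `j + 1` has weight at least that of `e j`.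
    have hlow : (G'.card : ℝ) * S.cutoffHat σ (e j) ≤
        ∑ i ∈ G', S.γ (e i) * S.C₀ ^ (e i).card := by
      rw [← nsmul_eq_mul]
      refine Finset.card_nsmul_le_sum _ _ _ fun i hi => ?_
      rw [← S.cutoffHat_of_mem (hmem i)]
      exact hanti (Set.mem_univ _) (Set.mem_univ _)
        (Nat.lt_succ_iff.1 (Finset.mem_range.1 (Finset.mem_filter.1 hi).1))
    have hnn : 0 ≤ S.cutoffHat σ (e j) := by
      have hC0 : 0 < S.C₀ := S.C₀_pos
      rw [S.cutoffHat_of_mem (hmem j)]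
      exact mul_nonneg (S.γ_nonneg _) (by positivity)
    have hhalf : m / 2 * S.cutoffHat σ (e j) ≤ 2 * ε ^ 2 :=
      (mul_le_mul_of_nonneg_right (by linarith) hnn).trans (hlow.trans hsum2)
    have hε2 : ε ^ 2 = (2 * D) ^ (2 * r) * m ^ (-(2 * r)) := by
      rw [hε, ← Real.rpow_natCast, ← Real.rpow_mul hb0.le, hb,
        Real.div_rpow hm0.le (by positivity), div_eq_mul_inv, ← Real.rpow_neg (by positivity),
        mul_comm]
      congr 2 <;> push_cast <;> ring
    have hmm : m ^ (-(1 + 2 * r)) = m⁻¹ * m ^ (-(2 * r)) := by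
      rw [neg_add, Real.rpow_add hm0, Real.rpow_neg_one]
    rw [hmm]
    rw [hε2] at hhalf
    have : S.cutoffHat σ (e j) ≤ 2 * ((2 * D) ^ (2 * r) * m ^ (-(2 * r))) / (m / 2) := by
      rw [le_div_iff₀ (by positivity)]; linarith
    refine this.trans (le_of_eq ?_)
    field_simp
    norm_num
  refine EReal.ge_of_forall_gt_iff_ge.1 fun q hq => le_sSup ⟨q, ⟨e, he, ?_⟩, rfl⟩
  rw [EReal.coe_lt_coe_iff] at hq
  have hq' : 0 < 1 + 2 * r - q := by
    have : 2 * s / (p * t) = 2 * r := by rw [hr]; ring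
    linarith
  simp only [hpos, Set.mem_univ, if_true]
  have hlim : Tendsto (fun j : ℕ => 4 * (2 * D) ^ (2 * r) * ((j : ℝ) + 1) ^ (-(1 + 2 * r - q)))
      atTop (𝓝 0) := by
    have h := ((tendsto_rpow_neg_atTop hq').comp
      (tendsto_atTop_add_const_right _ (1 : ℝ) tendsto_natCast_atTop_atTop)).const_mul
        (4 * (2 * D) ^ (2 * r))
    simpa using h
  refine tendsto_of_tendsto_of_tendsto_of_le_of_le' tendsto_const_nhds hlim
    (Eventually.of_forall fun j => ?_) ?_
  · have hC0 : 0 < S.C₀ := S.C₀_pos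
    rw [S.cutoffHat_of_mem (hmem j)]
    exact mul_nonneg (mul_nonneg (S.γ_nonneg _) (by positivity)) (by positivity)
  · obtain ⟨j₀, hj₀⟩ := exists_nat_gt (2 * D)
    filter_upwards [eventually_ge_atTop j₀] with j hj
    have hjr : (j₀ : ℝ) ≤ j := Nat.cast_le.2 hj
    calc S.cutoffHat σ (e j) * ((j : ℝ) + 1) ^ q
        ≤ 4 * (2 * D) ^ (2 * r) * ((j : ℝ) + 1) ^ (-(1 + 2 * r)) * ((j : ℝ) + 1) ^ q :=
          mul_le_mul_of_nonneg_right (hbound j (by linarith)) (by positivity)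
      _ = _ := by
          rw [mul_assoc, ← Real.rpow_add (by positivity)]
          congr 2
          ring

/-- A finite set `v` has at most `|v| ^ σ` non-empty subsets of cardinality at most `σ`. -/
theorem ncard_support_le (σ : ℕ) (v : Finset ℕ+) :
    (({u | u ∈ S.support σ ∧ u ⊆ v} : Set (Finset ℕ+)).ncard : ℝ) ≤ (v.card : ℝ) ^ (σ : ℝ) := by
  classical
  -- A non-empty `u` with at most `σ` elements is the image of a map `Fin σ → v`; there are `|v|^σ`
  -- such maps.
  have hsub : {u | u ∈ S.support σ ∧ u ⊆ v} ⊆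
      (((Fintype.piFinset fun _ : Fin σ => v).image fun g => Finset.univ.image g :
        Finset (Finset ℕ+)) : Set (Finset ℕ+)) := by
    rintro u ⟨hu, huv⟩
    have hcard : u.card ≤ σ := by
      by_contra h
      have := hu.2
      rw [cutoff, if_neg h] at this
      exact lt_irrefl _ this
    have : Nonempty u := hu.1.to_subtype
    obtain ⟨i⟩ : Nonempty (u ↪ Fin σ) := by
      rw [Function.Embedding.nonempty_iff_card_le]; simpa using hcard
    have hsurj := Function.invFun_surjective i.injective
    rw [Finset.mem_coe, Finset.mem_image]
    refine ⟨fun j => (Function.invFun i j : u), ?_, ?_⟩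
    · simpa using fun j => huv (Function.invFun i j : u).2
    · ext x
      simp only [Finset.mem_image, Finset.mem_univ, true_and]
      refine ⟨?_, fun hx => ?_⟩
      · rintro ⟨j, rfl⟩; exact (Function.invFun i j : u).2
      · obtain ⟨j, hj⟩ := hsurj ⟨x, hx⟩
        exact ⟨j, congrArg Subtype.val hj⟩
  have h := Set.ncard_le_ncard hsub (Finset.finite_toSet _)
  rw [Set.ncard_coe_finset] at h
  have h2 := h.trans Finset.card_image_le
  rw [Fintype.card_piFinset_const] at h2
  rw [Real.rpow_natCast]
  exact_mod_cast h2

end Setting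

end NestedSampling

namespace NestedSampling

/-! ### Univariate algorithms from algorithms for infinitely many variables -/

namespace RandAlg

variable {X Y : Type} (A : RandAlg X)

theorem transcript_succ_of_eq_some {f : X → ℝ} {ω : A.Ω} {n : ℕ} {x : X}
    (h : A.query ω (A.transcript f ω n) = some x) :
    A.transcript f ω (n + 1) = A.transcript f ω n ++ [f x] := by
  simp [transcript, h]

theorem transcript_succ_of_eq_none {f : X → ℝ} {ω : A.Ω} {n : ℕ}
    (h : A.query ω (A.transcript f ω n) = none) :
    A.transcript f ω (n + 1) = A.transcript f ω n := by
  simp [transcript, h]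

theorem transcript_of_point_ne_none {f : X → ℝ} {ω : A.Ω} {n : ℕ}
    (h : ∀ i < n, A.point f ω i ≠ none) :
    (A.transcript f ω n).length = n ∧
      ∀ i ≤ n, (A.transcript f ω n).take i = A.transcript f ω i := by
  induction n with
  | zero => simp [transcript]
  | succ n ih =>
    obtain ⟨hl, ht⟩ := ih fun i hi => h i (by omega)
    obtain ⟨x, hx⟩ := Option.ne_none_iff_exists'.1 (h n (by omega))
    have hs := A.transcript_succ_of_eq_some hx
    refine ⟨by simp [hs, hl], fun i hi => ?_⟩
    rcases hi.eq_or_lt with rfl | hi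
    · rw [List.take_of_length_le]
      simp [hs, hl]
    · rw [hs, List.take_append_of_le_length (by omega)]
      exact ht i (by omega)

theorem transcript_of_point_eq_none {f : X → ℝ} {ω : A.Ω} {m : ℕ} (h : A.point f ω m = none)
    {n : ℕ} (hn : m ≤ n) : A.transcript f ω n = A.transcript f ω m := by
  induction n, hn using Nat.le_induction with
  | base => rfl
  | succ n hn ih =>
    rw [point, ← ih] at h
    rw [← ih, A.transcript_succ_of_eq_none h]

theorem point_eq_none_of_le {f : X → ℝ} {ω : A.Ω} {m n : ℕ} (h : A.point f ω m = none)
    (hn : m ≤ n) : A.point f ω n = none := by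
  rw [point, A.transcript_of_point_eq_none h hn]
  exact h

theorem result_eq_zero {f : X → ℝ} {ω : A.Ω} (h : ∀ n, A.point f ω n ≠ none) :
    A.result f ω = 0 := by
  rw [result, dif_neg]
  rintro ⟨n, hn⟩
  exact h n hn

open Classical in
/-- The algorithm that replaces the sample points `x` of `A` by `π x`, and then evaluates the
function at `y₀` as long as `p` times the number of evaluations is covered by the cost of `A`. -/
noncomputable def simulate (π : X → Y) (y₀ : Y) (p : ℝ≥0∞) (c : X → ℝ≥0∞) : RandAlg Y where
  Ω := A.Ω
  P := A.P
  query ω l :=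
    -- A prefix on which `A` stops shows that `A` has finished. The shortest has length `Nat.find
    -- h`, the number of its evaluations, so later values are padding and the sum below is the full
    -- cost of `A`.
    if h : ∃ n, n ≤ l.length ∧ A.query ω (l.take n) = none then
      if ((l.length : ℝ≥0∞) + 1) * p ≤
          ∑ i ∈ Finset.range (Nat.find h), (A.query ω (l.take i)).elim 0 c then some y₀ else none
    else (A.query ω l).map π
  output ω l :=
    if h : ∃ n, n ≤ l.length ∧ A.query ω (l.take n) = none then
      A.output ω (l.take (Nat.find h)) else 0

variable {A} {π : X → Y} {y₀ : Y} {p : ℝ≥0∞} {c : X → ℝ≥0∞} {f : X → ℝ} {g : Y → ℝ} {ω : A.Ω}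

theorem simulate_query_of_point_ne_none {n : ℕ} (h : ∀ i ≤ n, A.point f ω i ≠ none) :
    (A.simulate π y₀ p c).query ω (A.transcript f ω n) = (A.point f ω n).map π := by
  obtain ⟨hl, ht⟩ := A.transcript_of_point_ne_none (f := f) (ω := ω) fun i hi => h i (le_of_lt hi)
  have hn : ¬∃ k, k ≤ (A.transcript f ω n).length ∧
      A.query ω ((A.transcript f ω n).take k) = none := by
    rintro ⟨k, hk, hq⟩
    rw [hl] at hk
    rw [ht k hk] at hq
    exact h k hk hq
  simp only [simulate]
  rw [dif_neg hn]
  rfl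

theorem simulate_transcript_of_point_ne_none (hfg : ∀ x, g (π x) = f x) {n : ℕ}
    (h : ∀ i < n, A.point f ω i ≠ none) :
    (A.simulate π y₀ p c).transcript g ω n = A.transcript f ω n := by
  induction n with
  | zero => rfl
  | succ n ih =>
    have hq := simulate_query_of_point_ne_none (π := π) (y₀ := y₀) (p := p) (c := c)
      (A := A) (f := f) (ω := ω) (n := n) fun i hi => h i (by omega)
    obtain ⟨x, hx⟩ := Option.ne_none_iff_exists'.1 (h n (by omega))
    rw [hx] at hq
    rw [point] at hx
    simp only [transcript, ih fun i hi => h i (by omega), hq, hx, Option.map_some, hfg]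

theorem simulate_point_of_point_ne_none (hfg : ∀ x, g (π x) = f x) {n : ℕ}
    (h : ∀ i ≤ n, A.point f ω i ≠ none) :
    (A.simulate π y₀ p c).point g ω n ≠ none := by
  change (A.simulate π y₀ p c).query ω ((A.simulate π y₀ p c).transcript g ω n) ≠ none
  rw [simulate_transcript_of_point_ne_none hfg fun i hi => h i (le_of_lt hi),
    simulate_query_of_point_ne_none h]
  simpa using h n le_rfl

section Stop

variable {m : ℕ}

theorem cost_eq_sum (hm : A.point f ω m = none) :
    A.cost c f ω = ∑ i ∈ Finset.range m, (A.point f ω i).elim 0 c :=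
  tsum_eq_sum fun i hi => by
    rw [A.point_eq_none_of_le hm (not_lt.1 fun h => hi (Finset.mem_range.2 h))]; rfl

theorem result_eq_output (hm : A.point f ω m = none) (hlt : ∀ i < m, A.point f ω i ≠ none) :
    A.result f ω = A.output ω (A.transcript f ω m) := by
  have h : ∃ n, A.point f ω n = none := ⟨m, hm⟩
  have hf : Nat.find h = m := (Nat.find_eq_iff h).2 ⟨hm, hlt⟩
  rw [result, dif_pos h, hf]

theorem exists_stop (hm : A.point f ω m = none) (hlt : ∀ i < m, A.point f ω i ≠ none)
    {l : List ℝ} (hl : m ≤ l.length) (ht : l.take m = A.transcript f ω m) :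
    ∃ h : ∃ n, n ≤ l.length ∧ A.query ω (l.take n) = none,
      Nat.find h = m ∧ ∀ i ≤ m, A.query ω (l.take i) = A.point f ω i := by
  have hq : ∀ i ≤ m, A.query ω (l.take i) = A.point f ω i := fun i hi => by
    rw [point, ← (A.transcript_of_point_ne_none hlt).2 i hi, ← ht, List.take_take, min_eq_left hi]
  have h : ∃ n, n ≤ l.length ∧ A.query ω (l.take n) = none := ⟨m, hl, by rw [hq m le_rfl, hm]⟩
  refine ⟨h, (Nat.find_eq_iff h).2 ⟨⟨hl, by rw [hq m le_rfl, hm]⟩, fun i hi hn => ?_⟩, hq⟩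
  rw [hq i hi.le] at hn
  exact hlt i hi hn.2

theorem simulate_query_of_stop (hm : A.point f ω m = none) (hlt : ∀ i < m, A.point f ω i ≠ none)
    {l : List ℝ} (hl : m ≤ l.length)
    (ht : l.take m = A.transcript f ω m) :
    (A.simulate π y₀ p c).query ω l =
      if ((l.length : ℝ≥0∞) + 1) * p ≤ A.cost c f ω then some y₀ else none := by
  obtain ⟨h, hfind, hq⟩ := exists_stop hm hlt hl ht
  simp only [simulate]
  rw [dif_pos h, cost_eq_sum hm, hfind,
    Finset.sum_congr rfl fun i hi => by rw [hq i (Finset.mem_range.1 hi).le]]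

theorem simulate_output_of_stop (hm : A.point f ω m = none) (hlt : ∀ i < m, A.point f ω i ≠ none)
    {l : List ℝ} (hl : m ≤ l.length)
    (ht : l.take m = A.transcript f ω m) :
    (A.simulate π y₀ p c).output ω l = A.result f ω := by
  obtain ⟨h, hfind, -⟩ := exists_stop hm hlt hl ht
  simp only [simulate]
  rw [dif_pos h, hfind, ht, result_eq_output hm hlt]

/-- Invariants of the padding phase, for induction on `n`: the transcript of `A` remains a prefix,
each step within the budget adds one value, and once the budget is exceeded no further evaluation is
affordable. -/
theorem simulate_transcript_of_stop (hm : A.point f ω m = none) (hlt : ∀ i < m, A.point f ω i ≠ none)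
    (hfg : ∀ x, g (π x) = f x) {n : ℕ} (hn : m ≤ n) :
    ((A.simulate π y₀ p c).transcript g ω n).take m = A.transcript f ω m ∧
    m ≤ ((A.simulate π y₀ p c).transcript g ω n).length ∧
    (n * p ≤ A.cost c f ω → ((A.simulate π y₀ p c).transcript g ω n).length = n) ∧
    (A.cost c f ω < n * p →
      A.cost c f ω < (((A.simulate π y₀ p c).transcript g ω n).length + 1) * p) := by
  induction n, hn using Nat.le_induction with
  | base =>
    rw [simulate_transcript_of_point_ne_none hfg hlt]
    obtain ⟨hl, ht⟩ := A.transcript_of_point_ne_none hlt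
    refine ⟨ht m le_rfl, hl.ge, fun _ => hl, fun h => h.trans_le ?_⟩
    rw [hl]
    gcongr
    exact le_self_add
  | succ n hn ih =>
    obtain ⟨h1, h2, h3, h4⟩ := ih
    have hq := simulate_query_of_stop (π := π) (y₀ := y₀) (p := p) (c := c) hm hlt h2 h1
    set l := (A.simulate π y₀ p c).transcript g ω n with hl
    have hle : (n : ℝ≥0∞) * p ≤ ((n + 1 : ℕ) : ℝ≥0∞) * p := by gcongr; simp
    by_cases hb : ((l.length : ℝ≥0∞) + 1) * p ≤ A.cost c f ω
    · rw [if_pos hb] at hq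
      have ht : (A.simulate π y₀ p c).transcript g ω (n + 1) = l ++ [g y₀] :=
        transcript_succ_of_eq_some _ hq
      have hlen := h3 (not_lt.1 fun h => (h4 h).not_ge hb)
      rw [ht]
      refine ⟨by rw [List.take_append_of_le_length h2, h1], by simp; omega,
        fun _ => by simp [hlen], fun h => ?_⟩
      rw [hlen] at hb
      exact absurd hb (not_le.2 (by simpa using h))
    · rw [if_neg hb] at hq
      have ht : (A.simulate π y₀ p c).transcript g ω (n + 1) = l :=
        transcript_succ_of_eq_none _ hq
      rw [ht]
      refine ⟨h1, h2, fun h => ?_, fun _ => not_le.1 hb⟩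
      rw [h3 (hle.trans h)] at hb
      exact absurd (by simpa using h) hb

end Stop

theorem cost_eq_top (hp : p ≠ 0) (hc : ∀ x, p ≤ c x) (h : ∀ n, A.point f ω n ≠ none) :
    A.cost c f ω = ⊤ := by
  refine top_unique ?_
  rw [← ENNReal.tsum_const_eq_top_of_ne_zero (α := ℕ) hp]
  refine ENNReal.tsum_le_tsum fun n => ?_
  obtain ⟨x, hx⟩ := Option.ne_none_iff_exists'.1 (h n)
  rw [hx]
  exact hc x

theorem mul_le_cost (hc : ∀ x, p ≤ c x) {n : ℕ} (h : ∀ i < n, A.point f ω i ≠ none) :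
    n * p ≤ A.cost c f ω := by
  refine le_trans ?_ (ENNReal.sum_le_tsum (Finset.range n))
  rw [← nsmul_eq_mul]
  nth_rewrite 1 [← Finset.card_range n]
  refine Finset.card_nsmul_le_sum _ _ _ fun i hi => ?_
  obtain ⟨x, hx⟩ := Option.ne_none_iff_exists'.1 (h i (Finset.mem_range.1 hi))
  rw [hx]
  exact hc x

/-- Stopping depends on `ω` only through the cost of `A`, which gives measurability. While `A` runs,
each evaluation costs it at least `p`; afterwards the padding rule is this inequality; if `A` never
stops, its cost is infinite. -/
theorem simulate_point_eq_none_iff (hp : p ≠ 0) (hc : ∀ x, p ≤ c x)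
    (hfg : ∀ x, g (π x) = f x) (n : ℕ) :
    (A.simulate π y₀ p c).point g ω n = none ↔ A.cost c f ω < (n + 1) * p := by
  classical
  by_cases h : ∃ m, A.point f ω m = none
  · set m := Nat.find h
    have hm : A.point f ω m = none := Nat.find_spec h
    have hlt : ∀ i < m, A.point f ω i ≠ none := fun i hi => Nat.find_min h hi
    rcases lt_or_ge n m with hn | hn
    · refine iff_of_false
        (simulate_point_of_point_ne_none hfg fun i hi => hlt i (by omega)) (not_lt.2 ?_)
      have := mul_le_cost hc (A := A) (f := f) (ω := ω) (n := n + 1) fun i hi => hlt i (by omega)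
      simpa using this
    · obtain ⟨h1, h2, h3, h4⟩ := simulate_transcript_of_stop (π := π) (y₀ := y₀) (p := p) (c := c)
        hm hlt hfg hn
      change (A.simulate π y₀ p c).query ω ((A.simulate π y₀ p c).transcript g ω n) = none ↔ _
      rw [simulate_query_of_stop hm hlt h2 h1, ite_eq_right_iff]
      simp only [reduceCtorEq, imp_false, not_le]
      rcases le_or_gt (n * p) (A.cost c f ω) with hb | hb
      · rw [h3 hb]
      · refine iff_of_true (h4 hb) (hb.trans_le ?_)
        gcongr
        exact le_self_add
  · push Not at h
    refine iff_of_false (simulate_point_of_point_ne_none hfg fun i _ => h i) ?_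
    rw [cost_eq_top hp hc h]
    exact not_top_lt

theorem simulate_cost (hp : p ≠ 0) (hc : ∀ x, p ≤ c x) (hfg : ∀ x, g (π x) = f x) :
    (A.simulate π y₀ p c).cost (fun _ => p) g ω =
      ∑' n : ℕ, if A.cost c f ω < (n + 1) * p then 0 else p := by
  refine tsum_congr fun n => ?_
  have h := simulate_point_eq_none_iff (A := A) (ω := ω) (y₀ := y₀) hp hc hfg n
  split_ifs with hb
  · rw [h.2 hb]; rfl
  · obtain ⟨x, hx⟩ := Option.ne_none_iff_exists'.1 (mt h.1 hb)
    rw [hx]; rfl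

/-- The term with index `n` is non-zero only if `n + 1` payments of `p` fit into `b`. -/
theorem tsum_ite_le (b p : ℝ≥0∞) : (∑' n : ℕ, if b < (n + 1) * p then 0 else p) ≤ b := by
  refine ENNReal.tsum_le_of_sum_range_le fun k => ?_
  induction k with
  | zero => simp
  | succ k ih =>
    rw [Finset.sum_range_succ]
    split_ifs with h
    · simpa using ih
    · refine le_trans ?_ (not_lt.1 h)
      rw [add_mul, one_mul]
      gcongr
      refine (Finset.sum_le_card_nsmul _ _ p fun i _ => ?_).trans (by simp)
      split_ifs <;> simp

theorem simulate_cost_le (hp : p ≠ 0) (hc : ∀ x, p ≤ c x) (hfg : ∀ x, g (π x) = f x) :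
    (A.simulate π y₀ p c).cost (fun _ => p) g ω ≤ A.cost c f ω := by
  rw [simulate_cost hp hc hfg]
  exact tsum_ite_le _ _

/-- At infinite cost the simulation never stops, even if `A` does, and the default result `0`
applies. At finite cost both stop, and the output ignores the padding. -/
theorem simulate_result (hp : 1 ≤ p) (hc : ∀ x, p ≤ c x) (hfg : ∀ x, g (π x) = f x) :
    (A.simulate π y₀ p c).result g ω = if A.cost c f ω < ⊤ then A.result f ω else 0 := by
  classical
  have hp0 : p ≠ 0 := (zero_lt_one.trans_le hp).ne'
  have hiff := simulate_point_eq_none_iff (A := A) (ω := ω) (y₀ := y₀) hp0 hc hfg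
  split_ifs with hb
  · have h : ∃ m, A.point f ω m = none := by
      by_contra! h
      exact hb.ne (cost_eq_top hp0 hc h)
    set m := Nat.find h
    have hm : A.point f ω m = none := Nat.find_spec h
    have hlt : ∀ i < m, A.point f ω i ≠ none := fun i hi => Nat.find_min h hi
    obtain ⟨n, hn⟩ := ENNReal.exists_nat_gt hb.ne
    have h' : ∃ k, (A.simulate π y₀ p c).point g ω k = none := by
      refine ⟨n, (hiff n).2 (hn.trans_le ?_)⟩
      calc (n : ℝ≥0∞) ≤ (n + 1) * 1 := by rw [mul_one]; exact le_self_add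
        _ ≤ (n + 1) * p := by gcongr
    have hk := Nat.find_spec h'
    set k := Nat.find h'
    have hmk : m ≤ k := by
      by_contra hlt'
      exact simulate_point_of_point_ne_none hfg (fun i hi => hlt i (by omega)) hk
    obtain ⟨h1, h2, -, -⟩ := simulate_transcript_of_stop (π := π) (y₀ := y₀) (p := p) (c := c)
      hm hlt hfg hmk
    rw [result_eq_output hk fun i hi => Nat.find_min h' hi, simulate_output_of_stop hm hlt h2 h1]
  · exact result_eq_zero _ fun n hn => hb (((hiff n).1 hn).trans_le le_top)

end RandAlg

/-! ### Transfer of the univariate lower bound -/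

namespace Setting

variable (S : Setting)

/-- `H(γ_{1} k)` is isometrically embedded into `ℋ_γ` via functions of the first variable. -/
theorem exists_lift (f : HilbertSpace (fun x y => S.γ {1} * S.k x y)
    (S.isKernel_k.smul (S.γ_nonneg {1}))) :
    ∃ F : S.Hγ, ‖F‖ = ‖f‖ ∧ ∀ x : S.domain, toFun F x = toFun f ((x : S.Pt) 1) := by
  obtain ⟨F, hF, h⟩ := exists_norm_eq_of_gram (fun t => S.component {1} fun _ => t)
    (fun x y => by simp [inner_component_component, kProd]) f
  refine ⟨F, hF, fun x => ?_⟩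
  rw [← inner_kfun]
  refine h _ _ fun y => ?_
  rw [inner_kfun, toFun_component]
  simp [kProd]

theorem toFun_univariate_anchor (f : HilbertSpace (fun x y => S.γ {1} * S.k x y)
    (S.isKernel_k.smul (S.γ_nonneg {1}))) : toFun f S.a = 0 := by
  have h : ‖kfun (S.isKernel_k.smul (S.γ_nonneg {1})) S.a‖ ^ 2 = 0 := by
    rw [← real_inner_self_eq_norm_sq, inner_kfun, toFun_kfun, S.anchored, mul_zero]
  rw [← inner_kfun, norm_eq_zero.1 (pow_eq_zero_iff two_ne_zero |>.1 h), inner_zero_left]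

open Classical in
/-- The first coordinate of the points of the domain; other points are sent to the anchor. -/
noncomputable def firstCoord (x : S.Pt) : S.D := if x ∈ S.domain then x 1 else S.a

/-- The simulation of `A` with price `$(1)` is an admissible competitor. Its cost is at most that of
`A`, and on the unit ball the results agree almost surely because the expected cost is finite. -/
theorem minError_univariate_le {A : RandAlg S.Pt} (hA : S.nested.IsAdmissible A) {N : ℝ}
    (hcost : S.nested.worstCost A < ENNReal.ofReal N) :
    S.univariate.minError N ≤ S.nested.error A := by
  rw [Problem.worstCost, iInf_lt_iff] at hcost
  obtain ⟨c, hcost⟩ := hcost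
  rw [iInf_lt_iff] at hcost
  obtain ⟨hc, hcost⟩ := hcost
  -- The sets `v i` are non-empty, so even the cheapest evaluation has at least one active variable.
  have hprice : ∀ x, S.price 1 ≤ c x := by
    obtain ⟨v, -, hv, rfl⟩ := id hc
    exact fun x => le_iInf₂ fun i _ => S.price_mono (hv i).card_pos
  have hp1 := S.one_le_price 1
  have hp0 : S.price 1 ≠ 0 := (zero_lt_one.trans_le hp1).ne'
  set B := A.simulate S.firstCoord S.a (S.price 1) c with hB
  have hlift : ∀ f : HilbertSpace (fun x y => S.γ {1} * S.k x y)
      (S.isKernel_k.smul (S.γ_nonneg {1})), ∃ F : S.Hγ, ‖F‖ = ‖f‖ ∧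
        (∀ x, toFun f (S.firstCoord x) = S.extend F x) ∧
        S.nested.functional (S.extend F) = S.univariate.functional (toFun f) := by
    intro f
    obtain ⟨F, hF, hFx⟩ := S.exists_lift f
    refine ⟨F, hF, fun x => ?_, ?_⟩
    -- Outside the domain the lifted function is `0` by convention, and `f` vanishes at the anchor,
    -- where such points are sent.
    · unfold firstCoord extend
      split_ifs with hx
      · exact (hFx ⟨x, hx⟩).symm
      · exact S.toFun_univariate_anchor f
    · rw [S.functional_extend F (fun x => toFun f (x 1)) hFx]
      have hm : Measurable (toFun f) :=
        measurable_toFun (fun y => (S.measurable_k_left y).const_mul _) f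
      have hmp := measurePreserving_eval_infinitePi (fun _ : ℕ+ => S.ρ) 1
      change _ = ∫ x, toFun f x ∂S.ρ
      rw [← hmp.map_eq, integral_map hmp.measurable.aemeasurable hm.aestronglyMeasurable]
      rfl
  refine iInf₂_le_of_le B ?_ (iInf_le_of_le ?_ ?_)
  · rintro _ ⟨f, rfl⟩
    obtain ⟨F, -, hFx, -⟩ := hlift f
    obtain ⟨⟨hrm, hr2⟩, hcm⟩ := hA (S.extend F) ⟨F, rfl⟩
    have hcm := hcm c hc
    have hres : B.result (toFun f) =
        fun ω => if A.cost c (S.extend F) ω < ⊤ then A.result (S.extend F) ω else 0 :=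
      funext fun ω => RandAlg.simulate_result hp1 hprice hFx
    have hmeas : Measurable (B.result (toFun f)) := by
      rw [hres]
      exact Measurable.ite (measurableSet_lt hcm measurable_const) hrm measurable_const
    refine ⟨⟨hmeas, hr2.mono hmeas.aestronglyMeasurable (ae_of_all _ fun ω => ?_)⟩, ?_⟩
    · rw [hres]
      dsimp only
      split_ifs
      · exact le_rfl
      · simp
    · rintro _ rfl
      have : B.cost (fun _ => S.price 1) (toFun f) = fun ω =>
          ∑' n : ℕ, if A.cost c (S.extend F) ω < (n + 1) * S.price 1 then 0 else S.price 1 :=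
        funext fun ω => RandAlg.simulate_cost hp0 hprice hFx
      rw [this]
      exact Measurable.tsum fun n =>
        Measurable.ite (measurableSet_lt hcm measurable_const) measurable_const measurable_const
  · refine iInf₂_le_of_le _ rfl (iSup₂_le ?_)
    rintro _ ⟨f, hf, rfl⟩
    obtain ⟨F, hFn, hFx, -⟩ := hlift f
    refine (lintegral_mono fun ω => RandAlg.simulate_cost_le hp0 hprice hFx).trans
      (le_trans ?_ hcost.le)
    exact le_iSup₂_of_le (f := fun f _ => ∫⁻ ω, A.cost c f ω ∂A.P) (S.extend F)
      ⟨F, hFn.trans_le hf, rfl⟩ le_rfl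
  · refine ENNReal.rpow_le_rpow (iSup₂_le ?_) (by norm_num)
    rintro _ ⟨f, hf, rfl⟩
    obtain ⟨F, hFn, hFx, hFI⟩ := hlift f
    have hball : S.extend F ∈ S.nested.ball := ⟨F, hFn.trans_le hf, rfl⟩
    have hfin : ∀ᵐ ω ∂A.P, A.cost c (S.extend F) ω < ⊤ := by
      refine ae_lt_top ((hA _ ⟨F, rfl⟩).2 c hc) (ne_of_lt ?_)
      exact (le_iSup₂_of_le (f := fun f _ => ∫⁻ ω, A.cost c f ω ∂A.P) _ hball
        le_rfl).trans_lt (hcost.trans ENNReal.ofReal_lt_top)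
    refine le_iSup₂_of_le _ hball (le_of_eq (lintegral_congr_ae ?_))
    filter_upwards [hfin] with ω hω
    have hr : B.result (toFun f) ω = A.result (S.extend F) ω :=
      (RandAlg.simulate_result hp1 hprice hFx).trans (if_pos hω)
    rw [hr, hFI]

/-- The exponent is at least the one of univariate integration. -/
theorem two_div_le {α : ℝ} (hα : 0 < α)
    (huniv : ∃ c : ℝ, 0 < c ∧
      ∀ᶠ N : ℝ in atTop, ENNReal.ofReal (c * N ^ (-α / 2)) ≤ S.univariate.minError N)
    {C p : ℝ} (hC : 0 ≤ C) (hp : 0 < p)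
    (hcomp : ∀ ε : ℝ, 0 < ε → ε < 1 → S.nested.comp ε ≤ ENNReal.ofReal (C * ε ^ (-p))) :
    2 / α ≤ p := by
  by_contra! hlt
  obtain ⟨c, hc, hev⟩ := huniv
  have hexp : 0 < 1 / p - α / 2 := by
    have h := (lt_div_iff₀ hα).1 hlt
    have : 1 / p - α / 2 = (2 - p * α) / (2 * p) := by field_simp
    rw [this]
    exact div_pos (by linarith) (by linarith)
  have hlim := ((tendsto_rpow_neg_atTop hexp).const_mul ((C + 1) ^ (1 / p)))
  rw [mul_zero] at hlim
  obtain ⟨x, h1, h2, h3⟩ := (hev.and ((eventually_gt_atTop (C + 1)).and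
    (hlim.eventually_lt_const hc))).exists
  have hx : 0 < x := by linarith
  -- This is the accuracy reachable at cost `x`. If `1/p > α/2`, it is eventually below `c
  -- x^(-α/2)`, contradicting the univariate bound.
  set ε := ((C + 1) / x) ^ (1 / p) with hε
  have hε0 : 0 < ε := by positivity
  have hε1 : ε < 1 := Real.rpow_lt_one (by positivity) ((div_lt_one hx).2 h2) (by positivity)
  have hεp : (C + 1) * ε ^ (-p) = x := by
    rw [hε, ← Real.rpow_mul (by positivity)]
    have : 1 / p * -p = -1 := by field_simp
    rw [this, Real.rpow_neg_one]
    field_simp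
  have hlt : S.nested.comp ε < ENNReal.ofReal x := by
    rw [← hεp]
    refine (hcomp ε hε0 hε1).trans_lt ((ENNReal.ofReal_lt_ofReal_iff (by positivity)).2 ?_)
    have : 0 < ε ^ (-p) := by positivity
    linarith
  simp only [Problem.comp, iInf_lt_iff] at hlt
  obtain ⟨A, hA, herr, hcost⟩ := hlt
  have h4 := (ENNReal.ofReal_le_ofReal_iff hε0.le).1
    (h1.trans ((S.minError_univariate_le hA hcost).trans herr))
  rw [hε, Real.div_rpow (by positivity) hx.le, div_eq_mul_inv ((C + 1) ^ (1 / p)),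
    ← Real.rpow_neg hx.le] at h4
  have h5 : x ^ (-(1 / p - α / 2)) * x ^ (-α / 2) = x ^ (-(1 / p)) := by
    rw [← Real.rpow_add hx]
    congr 1
    ring
  rw [← h5, ← mul_assoc] at h4
  exact absurd (le_of_mul_le_mul_right h4 (by positivity)) (not_le.2 h3)

end Setting

end NestedSampling

/-! ### Conclusion: both claims -/

namespace NestedSampling

theorem Problem.CompBound.comp_le {X : Type} {T : Problem X} {C p q : ℝ} (h : T.CompBound C p)
    (hC : 0 ≤ C) (hpq : p ≤ q) (ε : ℝ) (hε : 0 < ε) (hε1 : ε < 1) :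
    T.comp ε ≤ ENNReal.ofReal (C * ε ^ (-q)) :=
  (h ε hε).trans (ENNReal.ofReal_le_ofReal (mul_le_mul_of_nonneg_left
    (Real.rpow_le_rpow_of_exponent_ge hε hε1.le (by linarith)) hC))

theorem Setting.tStar_nonneg (S : Setting) (σ : ℕ) : 0 ≤ S.tStar σ := by
  refine le_sInf ?_
  rintro _ ⟨t, ht, rfl⟩
  exact EReal.coe_nonneg.2 ht.1

theorem Setting.tStar_le (S : Setting) (σ : ℕ) : S.tStar σ ≤ (σ : ℝ) := by
  refine sInf_le ⟨σ, ⟨Nat.cast_nonneg σ, 1, one_pos, fun v => ?_⟩, rfl⟩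
  rw [one_mul]
  exact S.ncard_support_le σ v

end NestedSampling

theorem theorem3p3 (S : NestedSampling.Setting)
    (s : ℝ) (hs : 0 < s)
    (hprice : ∃ c : ℝ, 0 < c ∧
      ∀ᶠ ν : ℕ in atTop, ENNReal.ofReal (c * (ν : ℝ) ^ s) ≤ S.price ν)
    (hγ : 0 < S.γ {1})
    (α : ℝ) (hα : 0 < α)
    (huniv : ∃ c : ℝ, 0 < c ∧
      ∀ᶠ N : ℝ in atTop, ENNReal.ofReal (c * N ^ (-α / 2)) ≤ S.univariate.minError N) :
    (S.nested.StronglyPolynomiallyTractable → ∀ σ : ℕ, 1 ≤ σ → 1 < S.decay σ) ∧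
    ((∀ σ : ℕ, 1 ≤ σ → 1 < S.decay σ) →
      max ((2 / α : ℝ) : EReal)
          (⨆ (σ : ℕ) (_ : 1 ≤ σ), (((2 * s : ℝ) : EReal) / S.tStar σ) / (S.decay σ - 1))
        ≤ S.nested.exponent) := by
  refine ⟨?_, fun hdecay => ?_⟩
  · rintro ⟨C, p, hC, hp, hbound⟩ σ hσ
    -- Raising the exponent to `p + 1` avoids a division by zero and keeps the bound for `ε < 1`.
    have hp' : 0 < p + 1 := by linarith
    have hσ' : (0 : ℝ) < σ := by exact_mod_cast hσ
    refine lt_of_lt_of_le ?_ (S.le_decay hs hprice hC hp' (hbound.comp_le hC (by linarith))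
      hσ' one_pos fun v => by rw [one_mul]; exact S.ncard_support_le σ v)
    rw [← EReal.coe_one, EReal.coe_lt_coe_iff]
    exact lt_add_of_pos_right _ (by positivity)
  · refine le_sInf ?_
    rintro _ ⟨p, ⟨hp, C, hC, hbound⟩, rfl⟩
    -- For `p = 0` the bound would also hold with exponent `1/α`, forcing `2/α ≤ 1/α`.
    have hp0 : 0 < p := by
      by_contra h
      have := S.two_div_le hα huniv hC.le (p := 1 / α) (by positivity)
        (hbound.comp_le hC.le ((not_lt.1 h).trans (by positivity)))
      rw [div_le_div_iff_of_pos_right hα] at this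
      norm_num at this
    have hcomp := hbound.comp_le hC.le le_rfl
    refine max_le (EReal.coe_le_coe_iff.2 (S.two_div_le hα huniv hC.le hp0 hcomp))
      (iSup₂_le fun σ hσ => ?_)
    have h1 := hdecay σ hσ
    have hnonneg : (0 : EReal) ≤ (p : EReal) := EReal.coe_nonneg.2 hp
    have ht0 := S.tStar_nonneg σ
    have htle := S.tStar_le σ
    obtain ⟨t, ht⟩ : ∃ t : ℝ, S.tStar σ = t := ⟨(S.tStar σ).toReal, (EReal.coe_toReal
      (ne_of_lt (htle.trans_lt (EReal.coe_lt_top _)))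
      (ne_of_gt (lt_of_lt_of_le EReal.bot_lt_zero ht0))).symm⟩
    rcases eq_or_ne (S.decay σ) ⊤ with hd | hd
    · rw [hd, ← EReal.coe_one, EReal.top_sub_coe, EReal.div_top]
      exact hnonneg
    obtain ⟨d, hd⟩ : ∃ d : ℝ, S.decay σ = d := ⟨(S.decay σ).toReal, (EReal.coe_toReal hd
      (ne_of_gt (bot_lt_iff_ne_bot.2 (ne_bot_of_gt h1)))).symm⟩
    rw [ht] at ht0 ⊢
    rw [hd] at h1 ⊢
    rw [← EReal.coe_one, EReal.coe_lt_coe_iff] at h1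
    rw [← EReal.coe_one, ← EReal.coe_sub, ← EReal.coe_div, ← EReal.coe_div, EReal.coe_le_coe_iff]
    rcases (EReal.coe_nonneg.1 ht0).eq_or_lt with h0 | h0
    -- For `t*_σ = 0` the quotient `2s / 0` is `0` by convention, so the term is trivially bounded.
    · rw [← h0]; simpa using hp
    -- The infimum `t*_σ` need not be attained: the decay bound is used at an admissible `τ < t'`,
    -- and `t'` then decreases to `t`.
    have hle : ∀ t' : ℝ, t < t' → 2 * s / (p * (d - 1)) ≤ t' := by
      intro t' htt'
      have hlt : S.tStar σ < (t' : EReal) := by rw [ht]; exact EReal.coe_lt_coe_iff.2 htt'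
      obtain ⟨_, ⟨τ, ⟨hτn, Cτ, hCτ, hcount⟩, rfl⟩, hτ⟩ := sInf_lt_iff.1 hlt
      have hτ' : t ≤ τ := by
        have : S.tStar σ ≤ (τ : EReal) := sInf_le ⟨τ, ⟨hτn, Cτ, hCτ, hcount⟩, rfl⟩
        rw [ht] at this; exact EReal.coe_le_coe_iff.1 this
      have hτ0 : 0 < τ := h0.trans_le hτ'
      have h := S.le_decay hs hprice hC.le hp0 hcomp hτ0 hCτ hcount
      rw [hd, EReal.coe_le_coe_iff] at h
      have h2 : 2 * s / (p * τ) ≤ d - 1 := by linarith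
      rw [div_le_iff₀ (by positivity)] at h2
      refine le_trans ?_ (EReal.coe_lt_coe_iff.1 hτ).le
      rw [div_le_iff₀ (mul_pos hp0 (by linarith))]
      linarith
    have h := le_of_forall_gt_imp_ge_of_dense hle
    rw [div_le_iff₀ (mul_pos hp0 (by linarith))] at h
    rw [div_le_iff₀ (by linarith), div_le_iff₀ h0]
    linarith
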